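/- **Setting.** Let $(\mathcal A^*,d)$ be a graded-commutative differential graded algebra over $\mathbb Q$ (unital, $\mathbb Z$-graded, $d$ of degree $+1$), with closed elements $\mathcal Z^*$ and cohomology algebra $H^*$. For a graded vector space $V$, let $\mathcal G^pV$ and $\mathcal A^pV$ be the quotients of $V^{\otimes p}$ by the relations of graded symmetry and graded antisymmetry. Products of maps carry the usual Koszul signs. For homogeneous $x,y$ and a map $g$ of degree $s$: - $fg:V\otimes W\to\mathcal A$ is $x\otimes y\mapsto(-1)^{s|x|}f(x)g(y)$; - $fg:\mathcal G^2V\to\mathcal A$ is $xy\mapsto(-1)^{s|x|}f(x)g(y)+(-1)^{s|y|+|x||y|}f(y)g(x)$; - $f\wedge g:\mathcal A^2V\to\mathcal A$ is $x\wedge y\mapsto(-1)^{s|x|}f(x)g(y)-(-1)^{s|y|+|x||y|}f(y)g(x)$; - $f^2=\tfrac12ff$ on $\mathcal G^2V$ if $f$ has degree $0$, and $f^2=\tfrac12f\wedge f$ on $\mathcal A^2V$ if $f$ has degree $-1$. The same conventions apply to maps with values in $H^*$. **Choices.** Let $E^*\subseteq\mathcal G^2H^*$ be the kernel of the product map $\mathcal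 G^2H^*\to H^*$. A *cochain choice* is a pair $c=(\alpha,\gamma)$, where $\alpha:H^*\to\mathcal Z^*$ is a linear right inverse, of degree $0$, of the projection to cohomology, and $\gamma:E^*\to\mathcal A^{*-1}$ is linear with $d\gamma=\alpha^2|_{E^*}$. Put $L_1=\mathrm{Hom}(H^*,H^{*-1})$ and $L_2=\mathrm{Hom}(E^*,H^{*-1})$ (maps of degree $-1$), and let $\mathrm{Id}\,L_1\subseteq L_2$ be the subspace of the restrictions to $E^*$ of the products $\mathrm{Id}\,n:\mathcal G^2H^*\to H^{*-1}$ with $n\in L_1$. For choices $c,c'$ pick $\beta:H^*\to\mathcal A^{*-1}$ with $d\beta=\alpha'-\alpha$. Then $\gamma'-\gamma-\beta(\alpha+\tfrac12d\beta)$ takes closed values on $E^*$, and the map $\delta(c',c):E^*\to H^{*-1}$ that it induces has a class in $L_2/\mathrm{Id}\,L_1$ that does not depend on $\beta$. Call $c$ and $c'$ equivalent if this class is $0$. The set $\mathcal C$ of equivalence classes is an affine space over $L_2/\mathrm{Id}\,L_1$, with $c'-c$ the class of $\delta(c',c)$. **Massey tensors.** Let $K[H^*\otimes E^*]$ be the kernel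 of the symmetrisation map $H^*\otimes E^*\to\mathcal G^3H^*$. The *uniform triple product* $\mathcal T_c:K[H^*\otimes E^*]\to H^{*-1}$ is the map induced by the restriction of $\alpha\gamma:H^*\otimes E^*\to\mathcal A^{*-1}$. Let $\mathcal D^*$ be the kernel of the restriction to $H^*\otimes\mathcal A^2E^*$ of $$\mathfrak m:H^*\otimes\mathcal A^2\mathcal G^2H^*\to\mathcal G^3H^*\otimes\mathcal G^2H^*,\qquad q\otimes(e\wedge f)\mapsto(qe)\otimes f-(-1)^{|e||f|}(qf)\otimes e .$$ The *pentagonal Massey tensor* $\mathcal P_c:\mathcal D^*\to H^{*-2}$ is the map induced by the restriction of $\alpha\gamma^2:H^*\otimes\mathcal A^2E^*\to\mathcal A^{*-2}$, which takes closed values on $\mathcal D^*$. With $j:\mathcal A^2E^*\to E^*\otimes E^*$, $e\wedge f\mapsto e\otimes f-(-1)^{|e||f|}f\otimes e$, the map $\mathrm{Id}\,j$ sends $\mathcal D^*$ into $K[H^*\otimes E^*]\otimes E^*$. **Theorem 4.10.** 1. Let $c$ and $c'$ be cochain choices, and let $\delta\in L_2$ be any representative of $c'-c\in L_2/\mathrm{Id}\,L_1$.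 Then $$\mathcal P_{c'}-\mathcal P_c=(\mathcal T_c\,\delta)\circ(\mathrm{Id}\,j)+\mathrm{Id}\,\delta^2:\mathcal D^*\to H^{*-2}.$$ 2. For fixed $c$, the right-hand side depends only on the class of $\delta$ in $L_2/\mathrm{Id}\,L_1$. 3. The map $c\mapsto\mathcal P_c$ descends to an affine quadratic function $\mathcal C\to\mathrm{Hom}(\mathcal D^*,H^{*-2})$: there is a bilinear map $B$ from $(L_2/\mathrm{Id}\,L_1)\times(L_2/\mathrm{Id}\,L_1)$ to $\mathrm{Hom}(\mathcal D^*,H^{*-2})$, independent of $c$, with $B([\delta],[\varepsilon])=\mathrm{Id}(\delta\wedge\varepsilon)$ for all $\delta,\varepsilon\in L_2$, such that for all $c\in\mathcal C$ $$\mathcal P_{c+[\delta]+[\varepsilon]}-\mathcal P_{c+[\delta]}-\mathcal P_{c+[\varepsilon]}+\mathcal P_c=\mathrm{Id}(\delta\wedge\varepsilon).$$ -/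

import Mathlib

open scoped TensorProduct

universe u

noncomputable section

/-- A `ℤ`-grading of a rational vector space `V`: a direct sum decomposition `V = ⨁ₙ Vⁿ`. -/
structure Grading (V : Type*) [AddCommGroup V] [Module ℚ V] where
  /-- the homogeneous part of each degree -/
  deg : ℤ → Submodule ℚ V
  isInternal : DirectSum.IsInternal deg

namespace Grading

variable {V W U : Type*} [AddCommGroup V] [Module ℚ V] [AddCommGroup W] [Module ℚ W]
  [AddCommGroup U] [Module ℚ U]

theorem bijective_coe (G : Grading V) : Function.Bijective (DirectSum.coeLinearMap G.deg) :=
  G.isInternal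

/-- The linear map on `V` with prescribed restrictions to the homogeneous parts. -/
def lift (G : Grading V) (f : ∀ i, G.deg i →ₗ[ℚ] W) : V →ₗ[ℚ] W :=
  DirectSum.toModule ℚ ℤ W f ∘ₗ
    (LinearEquiv.ofBijective (DirectSum.coeLinearMap G.deg) G.bijective_coe).symm.toLinearMap

theorem lift_of_mem (G : Grading V) (f : ∀ i, G.deg i →ₗ[ℚ] W) {i : ℤ} {x : V}
    (hx : x ∈ G.deg i) : G.lift f x = f i ⟨x, hx⟩ := by
  have : (LinearEquiv.ofBijective (DirectSum.coeLinearMap G.deg) G.bijective_coe).symm x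
      = DirectSum.lof ℚ ℤ (fun i => G.deg i) i ⟨x, hx⟩ := by
    rw [LinearEquiv.symm_apply_eq]
    simp
  simp [lift, this]

theorem iSup_deg (G : Grading V) : ⨆ i, G.deg i = ⊤ :=
  G.isInternal.submodule_iSup_eq_top

theorem hom_ext (G : Grading V) {f g : V →ₗ[ℚ] W}
    (h : ∀ i, ∀ x ∈ G.deg i, f x = g x) : f = g := by
  have : (⊤ : Submodule ℚ V) ≤ LinearMap.eqLocus f g := by
    rw [← G.iSup_deg]
    exact iSup_le fun i x hx => h i x hx
  exact LinearMap.ext fun x => this trivial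

theorem tensor_ext (G : Grading V) (G' : Grading W) {f g : V ⊗[ℚ] W →ₗ[ℚ] U}
    (h : ∀ i, ∀ x ∈ G.deg i, ∀ j, ∀ y ∈ G'.deg j, f (x ⊗ₜ y) = g (x ⊗ₜ y)) : f = g := by
  apply TensorProduct.ext
  refine G.hom_ext fun i x hx => G'.hom_ext fun j y hy => ?_
  exact h i x hx j y hy

/-- All homogeneous components of a vector. -/
def comp (G : Grading V) : V →ₗ[ℚ] (ℤ →₀ V) :=
  G.lift fun i => Finsupp.lsingle i ∘ₗ (G.deg i).subtype

theorem comp_of_mem (G : Grading V) {i : ℤ} {x : V} (hx : x ∈ G.deg i) :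
    G.comp x = Finsupp.single i x := by
  rw [comp, lift_of_mem _ _ hx]; rfl

/-- The projection onto the homogeneous part of degree `i`. -/
def proj (G : Grading V) (i : ℤ) : V →ₗ[ℚ] V := Finsupp.lapply i ∘ₗ G.comp

theorem proj_same (G : Grading V) {i : ℤ} {x : V} (hx : x ∈ G.deg i) : G.proj i x = x := by
  simp [proj, G.comp_of_mem hx]

theorem proj_ne (G : Grading V) {i j : ℤ} {x : V} (hx : x ∈ G.deg i) (h : i ≠ j) :
    G.proj j x = 0 := by
  simp [proj, G.comp_of_mem hx, Finsupp.single_eq_of_ne' h]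

theorem proj_mem (G : Grading V) (i : ℤ) (x : V) : G.proj i x ∈ G.deg i := by
  have : (⊤ : Submodule ℚ V) ≤ (G.deg i).comap (G.proj i) := by
    rw [← G.iSup_deg]
    refine iSup_le fun j y hy => ?_
    by_cases h : j = i
    · subst h; simpa [G.proj_same hy] using hy
    · simp [G.proj_ne hy h]
  exact this trivial

theorem sum_comp (G : Grading V) (x : V) : (G.comp x).sum (fun _ y => y) = x := by
  have : (Finsupp.lsum ℚ fun _ : ℤ => (LinearMap.id : V →ₗ[ℚ] V)) ∘ₗ G.comp = LinearMap.id :=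
    G.hom_ext fun i x hx => by simp [G.comp_of_mem hx]
  exact LinearMap.congr_fun this x

/-- A decomposition can be given by listing the components of each vector. -/
theorem isInternal_of_comp (deg : ℤ → Submodule ℚ V) (comp : V →ₗ[ℚ] (ℤ →₀ V))
    (h1 : ∀ v i, comp v i ∈ deg i) (h2 : ∀ i, ∀ v ∈ deg i, comp v = Finsupp.single i v)
    (h3 : ∀ v, (comp v).sum (fun _ y => y) = v) : DirectSum.IsInternal deg := by
  classical
  constructor
  · rw [← AddMonoidHom.coe_coe, injective_iff_map_eq_zero]
    intro x hx
    have key : ∀ x : DirectSum ℤ (fun i => deg i), ∀ i,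
        comp (DirectSum.coeLinearMap deg x) i = (x i : V) := by
      intro x i
      induction x using DirectSum.induction_on with
      | zero => simp
      | of j y =>
        have : DirectSum.coeLinearMap deg (DirectSum.of (fun i => deg i) j y) = (y : V) :=
          DirectSum.coeLinearMap_lof deg j y
        rw [this, h2 j _ y.2]
        by_cases h : j = i
        · subst h; simp
        · rw [Finsupp.single_eq_of_ne' h, DirectSum.of_eq_of_ne _ _ _ (Ne.symm h)]; rfl
      | add x y hx hy => simp [hx, hy]
    ext i
    have hx' : DirectSum.coeLinearMap deg x = 0 := hx
    rw [← key x i, hx']; simp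
  · intro v
    refine ⟨∑ i ∈ (comp v).support, DirectSum.of (fun i => deg i) i ⟨comp v i, h1 v i⟩, ?_⟩
    rw [map_sum]
    conv_rhs => rw [← h3 v]
    exact Finset.sum_congr rfl fun i _ => DirectSum.coeAddMonoidHom_of deg i _

/-- A subspace is homogeneous if it contains the components of its elements. -/
def IsHomogeneous (G : Grading V) (S : Submodule ℚ V) : Prop :=
  ∀ i, ∀ v ∈ S, G.proj i v ∈ S

theorem isHomogeneous_span (G : Grading V) (s : Set V) (h : ∀ v ∈ s, ∃ i, v ∈ G.deg i) :
    G.IsHomogeneous (Submodule.span ℚ s) := by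
  intro i v hv
  induction hv using Submodule.span_induction with
  | mem x hx =>
    obtain ⟨j, hj⟩ := h x hx
    by_cases hij : j = i
    · subst hij; rw [G.proj_same hj]; exact Submodule.subset_span hx
    · rw [G.proj_ne hj hij]; exact zero_mem _
  | zero => simp
  | add x y _ _ hx hy => rw [map_add]; exact add_mem hx hy
  | smul a x _ hx => rw [map_smul]; exact Submodule.smul_mem _ _ hx

/-- The linear maps `V → W` of degree `k`, i.e. those with `f(Vⁿ) ⊆ Wⁿ⁺ᵏ`. -/
def homs (G : Grading V) (G' : Grading W) (k : ℤ) : Submodule ℚ (V →ₗ[ℚ] W) where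
  carrier := {f | ∀ n, ∀ x ∈ G.deg n, f x ∈ G'.deg (n + k)}
  add_mem' hf hg := fun n x hx => add_mem (hf n x hx) (hg n x hx)
  zero_mem' _ _ _ := zero_mem _
  smul_mem' a _ hf := fun n x hx => Submodule.smul_mem _ a (hf n x hx)

theorem mem_homs {G : Grading V} {G' : Grading W} {k : ℤ} {f : V →ₗ[ℚ] W} :
    f ∈ G.homs G' k ↔ ∀ n, ∀ x ∈ G.deg n, f x ∈ G'.deg (n + k) := Iff.rfl

theorem proj_comm {G : Grading V} {G' : Grading W} {k : ℤ} {f : V →ₗ[ℚ] W}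
    (hf : f ∈ G.homs G' k) (i : ℤ) (x : V) : G'.proj (i + k) (f x) = f (G.proj i x) := by
  have : G'.proj (i + k) ∘ₗ f = f ∘ₗ G.proj i := by
    refine G.hom_ext fun j y hy => ?_
    by_cases h : j = i
    · subst h; simp [G.proj_same hy, G'.proj_same (hf _ _ hy)]
    · simp [G.proj_ne hy h, G'.proj_ne (hf _ _ hy) (fun h' => h (add_right_cancel h'))]
  exact LinearMap.congr_fun this x

theorem isHomogeneous_ker {G : Grading V} {G' : Grading W} {k : ℤ} {f : V →ₗ[ℚ] W}
    (hf : f ∈ G.homs G' k) : G.IsHomogeneous (LinearMap.ker f) := by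
  intro i v hv
  rw [LinearMap.mem_ker] at hv ⊢
  rw [← proj_comm hf, hv, map_zero]

/-- The grading induced on a subspace that is homogeneous: `Sⁿ = S ∩ Vⁿ`. -/
def sub (G : Grading V) (S : Submodule ℚ V) (hS : G.IsHomogeneous S) : Grading S where
  deg n := (G.deg n).comap S.subtype
  isInternal := by
    obtain ⟨r, hr⟩ := LinearMap.exists_leftInverse_of_injective S.subtype S.ker_subtype
    have hr' : ∀ v (hv : v ∈ S), r v = ⟨v, hv⟩ := fun v hv => LinearMap.congr_fun hr ⟨v, hv⟩
    refine isInternal_of_comp _ (Finsupp.mapRange.linearMap r ∘ₗ G.comp ∘ₗ S.subtype) ?_ ?_ ?_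
    · intro v i
      have := hr' _ (hS i v v.2)
      have h2 : (Finsupp.mapRange.linearMap r ∘ₗ G.comp ∘ₗ S.subtype) v i
        = ⟨_, hS i v v.2⟩ := this
      rw [h2]
      exact G.proj_mem i v
    · intro i v hv
      simp only [LinearMap.comp_apply]
      rw [G.comp_of_mem hv]
      simp [hr']
    · intro v
      have := G.sum_comp (v : V)
      apply_fun r at this
      rw [hr' v v.2, Finsupp.sum, map_sum] at this
      simp only [LinearMap.comp_apply, Finsupp.mapRange.linearMap_apply]
      rw [Finsupp.sum_mapRange_index (fun _ => rfl)]
      exact this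

/-- The grading induced on the target of a surjection `π` with homogeneous kernel
(a quotient of `V`): the degree `n` part is `π(Vⁿ)`. -/
def quot (G : Grading V) (π : V →ₗ[ℚ] W) (hπ : Function.Surjective π)
    (hker : G.IsHomogeneous (LinearMap.ker π)) : Grading W where
  deg n := (G.deg n).map π
  isInternal := by
    obtain ⟨σ, hσ⟩ := LinearMap.exists_rightInverse_of_surjective π (LinearMap.range_eq_top.2 hπ)
    have hσ' : ∀ w, π (σ w) = w := fun w => LinearMap.congr_fun hσ w
    refine isInternal_of_comp _ (Finsupp.mapRange.linearMap π ∘ₗ G.comp ∘ₗ σ) ?_ ?_ ?_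
    · intro w i
      exact ⟨_, G.proj_mem i (σ w), rfl⟩
    · rintro i _ ⟨v, hv, rfl⟩
      ext j
      have h1 : π (G.proj j (σ (π v) - v)) = 0 := hker j _ (by simp [hσ'])
      rw [map_sub, map_sub, sub_eq_zero] at h1
      have h2 : (Finsupp.mapRange.linearMap π ∘ₗ G.comp ∘ₗ σ) (π v) j = π (G.proj j (σ (π v))) := rfl
      rw [h2, h1]
      by_cases h : i = j
      · subst h; simp [G.proj_same hv]
      · simp [G.proj_ne hv h, Finsupp.single_eq_of_ne' h]
    · intro w
      have := G.sum_comp (σ w)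
      apply_fun π at this
      rw [hσ', Finsupp.sum, map_sum] at this
      simp only [LinearMap.comp_apply, Finsupp.mapRange.linearMap_apply]
      rw [Finsupp.sum_mapRange_index (fun _ => rfl)]
      exact this

/-- The tensor product of two graded vector spaces, `|x ⊗ y| = |x| + |y|`. -/
def tensor (G : Grading V) (G' : Grading W) : Grading (V ⊗[ℚ] W) where
  deg n := Submodule.span ℚ
    {z | ∃ i j, i + j = n ∧ ∃ x ∈ G.deg i, ∃ y ∈ G'.deg j, z = x ⊗ₜ[ℚ] y}
  isInternal := by
    let c : V ⊗[ℚ] W →ₗ[ℚ] (ℤ →₀ V ⊗[ℚ] W) :=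
      Finsupp.lmapDomain _ ℚ (fun p : ℤ × ℤ => p.1 + p.2) ∘ₗ
        (finsuppTensorFinsupp ℚ ℚ V W ℤ ℤ).toLinearMap ∘ₗ TensorProduct.map G.comp G'.comp
    have hc : ∀ i, ∀ x ∈ G.deg i, ∀ j, ∀ y ∈ G'.deg j,
        c (x ⊗ₜ y) = Finsupp.single (i + j) (x ⊗ₜ y) := by
      intro i x hx j y hy
      simp [c, G.comp_of_mem hx, G'.comp_of_mem hy, Finsupp.mapDomain_single]
    refine isInternal_of_comp _ c ?_ ?_ ?_
    · intro v n
      set S : Submodule ℚ (V ⊗[ℚ] W) := Submodule.span ℚ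
        {z | ∃ i j, i + j = n ∧ ∃ x ∈ G.deg i, ∃ y ∈ G'.deg j, z = x ⊗ₜ[ℚ] y} with hS
      have : S.mkQ ∘ₗ Finsupp.lapply n ∘ₗ c = 0 := by
        refine G.tensor_ext G' fun i x hx j y hy => ?_
        simp only [LinearMap.comp_apply, hc i x hx j y hy]
        by_cases h : i + j = n
        · subst h
          simp only [Finsupp.lapply_apply, Finsupp.single_eq_same, LinearMap.zero_apply,
            Submodule.mkQ_apply, Submodule.Quotient.mk_eq_zero]
          exact Submodule.subset_span ⟨i, j, rfl, x, hx, y, hy, rfl⟩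
        · simp [Finsupp.single_eq_of_ne' h]
      have := LinearMap.congr_fun this v
      simpa using this
    · intro n v hv
      induction hv using Submodule.span_induction with
      | mem z hz =>
        obtain ⟨i, j, rfl, x, hx, y, hy, rfl⟩ := hz
        exact hc i x hx j y hy
      | zero => simp
      | add x y _ _ hx hy => rw [map_add, hx, hy, Finsupp.single_add]
      | smul a x _ hx => rw [map_smul, hx, Finsupp.smul_single]
    · intro v
      have : (Finsupp.lsum ℚ fun _ : ℤ => (LinearMap.id : V ⊗[ℚ] W →ₗ[ℚ] _)) ∘ₗ c
          = LinearMap.id :=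
        G.tensor_ext G' fun i x hx j y hy => by simp [hc i x hx j y hy]
      exact LinearMap.congr_fun this v

theorem tmul_mem (G : Grading V) (G' : Grading W) {i j : ℤ} {x : V} {y : W}
    (hx : x ∈ G.deg i) (hy : y ∈ G'.deg j) : x ⊗ₜ[ℚ] y ∈ (G.tensor G').deg (i + j) :=
  Submodule.subset_span ⟨i, j, rfl, x, hx, y, hy, rfl⟩

theorem mem_homs_tensor {G : Grading V} {G' : Grading W} {G'' : Grading U} {k : ℤ}
    {f : V ⊗[ℚ] W →ₗ[ℚ] U}
    (h : ∀ i, ∀ x ∈ G.deg i, ∀ j, ∀ y ∈ G'.deg j, f (x ⊗ₜ y) ∈ G''.deg (i + j + k)) :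
    f ∈ (G.tensor G').homs G'' k := by
  intro n z hz
  induction hz using Submodule.span_induction with
  | mem z hz =>
    obtain ⟨i, j, rfl, x, hx, y, hy, rfl⟩ := hz
    exact h i x hx j y hy
  | zero => simp
  | add x y _ _ hx hy => rw [map_add]; exact add_mem hx hy
  | smul a x _ hx => rw [map_smul]; exact Submodule.smul_mem _ _ hx

/-- `x ↦ (-1)^(k|x|) x`. -/
def twist (G : Grading V) (k : ℤ) : V →ₗ[ℚ] V :=
  G.lift fun i => ((-1 : ℚ) ^ (k * i)) • (G.deg i).subtype

theorem twist_of_mem (G : Grading V) (k : ℤ) {i : ℤ} {x : V} (hx : x ∈ G.deg i) :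
    G.twist k x = ((-1 : ℚ) ^ (k * i)) • x := by
  rw [twist, lift_of_mem _ _ hx]; rfl

/-- The graded swap `x ⊗ y ↦ (-1)^(|x||y|) y ⊗ x`. -/
def swap (G : Grading V) : V ⊗[ℚ] V →ₗ[ℚ] V ⊗[ℚ] V :=
  TensorProduct.lift (G.lift fun i =>
    LinearMap.lcomp ℚ (V ⊗[ℚ] V) (G.twist i) ∘ₗ (TensorProduct.mk ℚ V V).flip ∘ₗ
      (G.deg i).subtype)

theorem swap_tmul (G : Grading V) {i j : ℤ} {x y : V} (hx : x ∈ G.deg i) (hy : y ∈ G.deg j) :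
    G.swap (x ⊗ₜ y) = ((-1 : ℚ) ^ (i * j)) • (y ⊗ₜ[ℚ] x) := by
  simp [swap, G.lift_of_mem _ hx, G.twist_of_mem i hy, TensorProduct.smul_tmul']

/-- The relations of graded symmetry in `V ⊗ V`. -/
def symRel (G : Grading V) : Submodule ℚ (V ⊗[ℚ] V) :=
  Submodule.span ℚ {z | ∃ i j, ∃ x ∈ G.deg i, ∃ y ∈ G.deg j,
    z = x ⊗ₜ[ℚ] y - ((-1 : ℚ) ^ (i * j)) • (y ⊗ₜ[ℚ] x)}

/-- The relations of graded antisymmetry in `V ⊗ V`. -/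
def altRel (G : Grading V) : Submodule ℚ (V ⊗[ℚ] V) :=
  Submodule.span ℚ {z | ∃ i j, ∃ x ∈ G.deg i, ∃ y ∈ G.deg j,
    z = x ⊗ₜ[ℚ] y + ((-1 : ℚ) ^ (i * j)) • (y ⊗ₜ[ℚ] x)}

theorem symRel_le (G : Grading V) {S : Submodule ℚ (V ⊗[ℚ] V)}
    (h : ∀ i, ∀ x ∈ G.deg i, ∀ j, ∀ y ∈ G.deg j,
      x ⊗ₜ[ℚ] y - ((-1 : ℚ) ^ (i * j)) • (y ⊗ₜ[ℚ] x) ∈ S) : G.symRel ≤ S := by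
  refine Submodule.span_le.2 ?_
  rintro _ ⟨i, j, x, hx, y, hy, rfl⟩
  exact h i x hx j y hy

theorem altRel_le (G : Grading V) {S : Submodule ℚ (V ⊗[ℚ] V)}
    (h : ∀ i, ∀ x ∈ G.deg i, ∀ j, ∀ y ∈ G.deg j,
      x ⊗ₜ[ℚ] y + ((-1 : ℚ) ^ (i * j)) • (y ⊗ₜ[ℚ] x) ∈ S) : G.altRel ≤ S := by
  refine Submodule.span_le.2 ?_
  rintro _ ⟨i, j, x, hx, y, hy, rfl⟩
  exact h i x hx j y hy

/-- The relations of graded symmetry in `V ⊗ V ⊗ V`, generated by adjacent transpositions. -/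
def symCubeRel (G : Grading V) : Submodule ℚ (V ⊗[ℚ] (V ⊗[ℚ] V)) :=
  Submodule.span ℚ
    ({t | ∃ i j, ∃ x ∈ G.deg i, ∃ y ∈ G.deg j, ∃ k, ∃ z ∈ G.deg k,
        t = x ⊗ₜ[ℚ] (y ⊗ₜ[ℚ] z) - ((-1 : ℚ) ^ (i * j)) • (y ⊗ₜ[ℚ] (x ⊗ₜ[ℚ] z))} ∪
     {t | ∃ i j, ∃ x ∈ G.deg i, ∃ y ∈ G.deg j, ∃ k, ∃ z ∈ G.deg k,
        t = z ⊗ₜ[ℚ] (x ⊗ₜ[ℚ] y) - ((-1 : ℚ) ^ (i * j)) • (z ⊗ₜ[ℚ] (y ⊗ₜ[ℚ] x))})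

/-- The graded symmetric square `𝒢²V`. -/
def SymSq (G : Grading V) := (V ⊗[ℚ] V) ⧸ G.symRel

/-- The graded antisymmetric square `𝒜²V`. -/
def AltSq (G : Grading V) := (V ⊗[ℚ] V) ⧸ G.altRel

/-- The graded symmetric cube `𝒢³V`. -/
def SymCube (G : Grading V) := (V ⊗[ℚ] (V ⊗[ℚ] V)) ⧸ G.symCubeRel

instance (G : Grading V) : AddCommGroup G.SymSq :=
  inferInstanceAs (AddCommGroup ((V ⊗[ℚ] V) ⧸ G.symRel))

instance (G : Grading V) : Module ℚ G.SymSq :=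
  inferInstanceAs (Module ℚ ((V ⊗[ℚ] V) ⧸ G.symRel))

instance (G : Grading V) : AddCommGroup G.AltSq :=
  inferInstanceAs (AddCommGroup ((V ⊗[ℚ] V) ⧸ G.altRel))

instance (G : Grading V) : Module ℚ G.AltSq :=
  inferInstanceAs (Module ℚ ((V ⊗[ℚ] V) ⧸ G.altRel))

instance (G : Grading V) : AddCommGroup G.SymCube :=
  inferInstanceAs (AddCommGroup ((V ⊗[ℚ] (V ⊗[ℚ] V)) ⧸ G.symCubeRel))

instance (G : Grading V) : Module ℚ G.SymCube :=
  inferInstanceAs (Module ℚ ((V ⊗[ℚ] (V ⊗[ℚ] V)) ⧸ G.symCubeRel))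

/-- The quotient map `V ⊗ V → 𝒢²V`. -/
def symMk (G : Grading V) : V ⊗[ℚ] V →ₗ[ℚ] G.SymSq := G.symRel.mkQ

/-- The quotient map `V ⊗ V → 𝒜²V`. -/
def altMk (G : Grading V) : V ⊗[ℚ] V →ₗ[ℚ] G.AltSq := G.altRel.mkQ

/-- The quotient map `V ⊗ V ⊗ V → 𝒢³V`. -/
def cubeMk (G : Grading V) : V ⊗[ℚ] (V ⊗[ℚ] V) →ₗ[ℚ] G.SymCube := G.symCubeRel.mkQ

theorem symMk_surjective (G : Grading V) : Function.Surjective G.symMk :=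
  G.symRel.mkQ_surjective

theorem altMk_surjective (G : Grading V) : Function.Surjective G.altMk :=
  G.altRel.mkQ_surjective

theorem cubeMk_surjective (G : Grading V) : Function.Surjective G.cubeMk :=
  G.symCubeRel.mkQ_surjective

theorem ker_symMk (G : Grading V) : LinearMap.ker G.symMk = G.symRel := G.symRel.ker_mkQ

theorem ker_altMk (G : Grading V) : LinearMap.ker G.altMk = G.altRel := G.altRel.ker_mkQ

theorem ker_cubeMk (G : Grading V) : LinearMap.ker G.cubeMk = G.symCubeRel :=
  G.symCubeRel.ker_mkQ

/-- The linear map on `𝒢²V` induced by a map on `V ⊗ V`. -/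
def symLift (G : Grading V) (f : V ⊗[ℚ] V →ₗ[ℚ] U) (hf : G.symRel ≤ LinearMap.ker f) :
    G.SymSq →ₗ[ℚ] U := G.symRel.liftQ f hf

/-- The linear map on `𝒜²V` induced by a map on `V ⊗ V`. -/
def altLift (G : Grading V) (f : V ⊗[ℚ] V →ₗ[ℚ] U) (hf : G.altRel ≤ LinearMap.ker f) :
    G.AltSq →ₗ[ℚ] U := G.altRel.liftQ f hf

/-- The linear map on `𝒢³V` induced by a map on `V ⊗ V ⊗ V`. -/
def cubeLift (G : Grading V) (f : V ⊗[ℚ] (V ⊗[ℚ] V) →ₗ[ℚ] U)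
    (hf : G.symCubeRel ≤ LinearMap.ker f) : G.SymCube →ₗ[ℚ] U := G.symCubeRel.liftQ f hf

theorem symLift_mk (G : Grading V) (f : V ⊗[ℚ] V →ₗ[ℚ] U) (hf) (z : V ⊗[ℚ] V) :
    G.symLift f hf (G.symMk z) = f z := rfl

theorem altLift_mk (G : Grading V) (f : V ⊗[ℚ] V →ₗ[ℚ] U) (hf) (z : V ⊗[ℚ] V) :
    G.altLift f hf (G.altMk z) = f z := rfl

theorem cubeLift_mk (G : Grading V) (f : V ⊗[ℚ] (V ⊗[ℚ] V) →ₗ[ℚ] U) (hf)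
    (z : V ⊗[ℚ] (V ⊗[ℚ] V)) : G.cubeLift f hf (G.cubeMk z) = f z := rfl

theorem symRel_homogeneous (G : Grading V) : (G.tensor G).IsHomogeneous G.symRel := by
  refine isHomogeneous_span _ _ ?_
  rintro _ ⟨i, j, x, hx, y, hy, rfl⟩
  refine ⟨i + j, sub_mem (G.tmul_mem G hx hy) (Submodule.smul_mem _ _ ?_)⟩
  rw [add_comm]; exact G.tmul_mem G hy hx

theorem altRel_homogeneous (G : Grading V) : (G.tensor G).IsHomogeneous G.altRel := by
  refine isHomogeneous_span _ _ ?_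
  rintro _ ⟨i, j, x, hx, y, hy, rfl⟩
  refine ⟨i + j, add_mem (G.tmul_mem G hx hy) (Submodule.smul_mem _ _ ?_)⟩
  rw [add_comm]; exact G.tmul_mem G hy hx

theorem symCubeRel_homogeneous (G : Grading V) :
    (G.tensor (G.tensor G)).IsHomogeneous G.symCubeRel := by
  refine isHomogeneous_span _ _ ?_
  rintro _ (⟨i, j, x, hx, y, hy, k, z, hz, rfl⟩ | ⟨i, j, x, hx, y, hy, k, z, hz, rfl⟩)
  · refine ⟨i + (j + k), sub_mem (G.tmul_mem _ hx (G.tmul_mem _ hy hz))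
      (Submodule.smul_mem _ _ ?_)⟩
    rw [add_left_comm]; exact G.tmul_mem _ hy (G.tmul_mem _ hx hz)
  · refine ⟨k + (i + j), sub_mem (G.tmul_mem _ hz (G.tmul_mem _ hx hy))
      (Submodule.smul_mem _ _ ?_)⟩
    rw [add_comm i j]; exact G.tmul_mem _ hz (G.tmul_mem _ hy hx)

/-- The grading of `𝒢²V`. -/
def symSq (G : Grading V) : Grading G.SymSq :=
  (G.tensor G).quot G.symMk G.symMk_surjective
    (by rw [G.ker_symMk]; exact G.symRel_homogeneous)

/-- The grading of `𝒜²V`. -/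
def altSq (G : Grading V) : Grading G.AltSq :=
  (G.tensor G).quot G.altMk G.altMk_surjective
    (by rw [G.ker_altMk]; exact G.altRel_homogeneous)

/-- The grading of `𝒢³V`. -/
def symCube (G : Grading V) : Grading G.SymCube :=
  (G.tensor (G.tensor G)).quot G.cubeMk G.cubeMk_surjective
    (by rw [G.ker_cubeMk]; exact G.symCubeRel_homogeneous)

theorem mem_homs_quot {G : Grading V} {π : V →ₗ[ℚ] W} {hπ : Function.Surjective π}
    {hk : G.IsHomogeneous (LinearMap.ker π)} {G' : Grading U} {k : ℤ} {f : W →ₗ[ℚ] U}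
    (h : f ∘ₗ π ∈ G.homs G' k) : f ∈ (G.quot π hπ hk).homs G' k := by
  rintro n _ ⟨x, hx, rfl⟩
  exact h n x hx

theorem symSq_ext (G : Grading V) {f g : G.SymSq →ₗ[ℚ] U}
    (h : ∀ i, ∀ x ∈ G.deg i, ∀ j, ∀ y ∈ G.deg j,
      f (G.symMk (x ⊗ₜ y)) = g (G.symMk (x ⊗ₜ y))) : f = g := by
  have := G.tensor_ext G (f := f ∘ₗ G.symMk) (g := g ∘ₗ G.symMk) h
  refine LinearMap.ext fun z => ?_
  obtain ⟨z, rfl⟩ := G.symMk_surjective z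
  exact LinearMap.congr_fun this z

theorem altSq_ext (G : Grading V) {f g : G.AltSq →ₗ[ℚ] U}
    (h : ∀ i, ∀ x ∈ G.deg i, ∀ j, ∀ y ∈ G.deg j,
      f (G.altMk (x ⊗ₜ y)) = g (G.altMk (x ⊗ₜ y))) : f = g := by
  have := G.tensor_ext G (f := f ∘ₗ G.altMk) (g := g ∘ₗ G.altMk) h
  refine LinearMap.ext fun z => ?_
  obtain ⟨z, rfl⟩ := G.altMk_surjective z
  exact LinearMap.congr_fun this z

theorem homs_comp {G : Grading V} {G' : Grading W} {G'' : Grading U} {k l m : ℤ}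
    {f : V →ₗ[ℚ] W} {g : W →ₗ[ℚ] U} (hg : g ∈ G'.homs G'' l) (hf : f ∈ G.homs G' k)
    (hm : k + l = m) : g ∘ₗ f ∈ G.homs G'' m := by
  subst hm
  intro n x hx
  rw [← add_assoc]
  exact hg _ _ (hf _ _ hx)

theorem lTensor_mem {T : Type*} [AddCommGroup T] [Module ℚ T] (G'' : Grading T)
    {G : Grading V} {G' : Grading W} {k : ℤ} {f : V →ₗ[ℚ] W} (hf : f ∈ G.homs G' k) :
    f.lTensor T ∈ (G''.tensor G).homs (G''.tensor G') k := by
  refine mem_homs_tensor fun i x hx j y hy => ?_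
  rw [add_assoc]
  exact G''.tmul_mem _ hx (hf _ _ hy)

theorem rTensor_mem {T : Type*} [AddCommGroup T] [Module ℚ T] (G'' : Grading T)
    {G : Grading V} {G' : Grading W} {k : ℤ} {f : V →ₗ[ℚ] W} (hf : f ∈ G.homs G' k) :
    f.rTensor T ∈ (G.tensor G'').homs (G'.tensor G'') k := by
  refine mem_homs_tensor fun i x hx j y hy => ?_
  rw [add_right_comm]
  exact G'.tmul_mem _ (hf _ _ hx) hy

theorem assoc_symm_mem (G : Grading V) (G' : Grading W) (G'' : Grading U) :
    (TensorProduct.assoc ℚ V W U).symm.toLinearMap ∈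
      (G.tensor (G'.tensor G'')).homs ((G.tensor G').tensor G'') 0 := by
  refine mem_homs_tensor fun i x hx j y hy => ?_
  induction hy using Submodule.span_induction with
  | mem z hz =>
    obtain ⟨k, l, rfl, y, hy, z, hz, rfl⟩ := hz
    rw [add_zero, ← add_assoc]
    exact tmul_mem _ _ (G.tmul_mem _ hx hy) hz
  | zero => simp
  | add y z _ _ hy hz => rw [TensorProduct.tmul_add, map_add]; exact add_mem hy hz
  | smul a y _ hy => rw [TensorProduct.tmul_smul, map_smul]; exact Submodule.smul_mem _ _ hy

theorem subtype_mem (G : Grading V) (S : Submodule ℚ V) (hS : G.IsHomogeneous S) :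
    S.subtype ∈ (G.sub S hS).homs G 0 := by
  intro n x hx
  rw [add_zero]
  exact hx

theorem neg_one_zpow_sq (n : ℤ) : ((-1 : ℚ) ^ n) * ((-1 : ℚ) ^ n) = 1 := by
  rw [← mul_zpow]; simp

/-- The inclusion `j : 𝒜²V → V ⊗ V`, `x ∧ y ↦ x ⊗ y - (-1)^(|x||y|) y ⊗ x`. -/
def altIncl (G : Grading V) : G.AltSq →ₗ[ℚ] V ⊗[ℚ] V :=
  G.altLift (LinearMap.id - G.swap) (by
    refine G.altRel_le fun i x hx j y hy => ?_
    simp only [LinearMap.mem_ker, map_add, map_smul, LinearMap.sub_apply,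
      LinearMap.id_apply, G.swap_tmul hx hy, G.swap_tmul hy hx, smul_sub, smul_smul,
      mul_comm j i, neg_one_zpow_sq, one_smul]
    abel)

theorem altIncl_mk (G : Grading V) {i j : ℤ} {x y : V} (hx : x ∈ G.deg i) (hy : y ∈ G.deg j) :
    G.altIncl (G.altMk (x ⊗ₜ y)) = x ⊗ₜ y - ((-1 : ℚ) ^ (i * j)) • (y ⊗ₜ[ℚ] x) := by
  rw [altIncl, G.altLift_mk, LinearMap.sub_apply,
    LinearMap.id_apply, G.swap_tmul hx hy]

/-- The product map `V ⊗ 𝒢²V → 𝒢³V`, `x ⊗ yz ↦ xyz`. -/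
def symMul (G : Grading V) : V ⊗[ℚ] G.SymSq →ₗ[ℚ] G.SymCube :=
  TensorProduct.lift (LinearMap.flip (G.symLift
    (LinearMap.flip (TensorProduct.curry G.cubeMk)) (by
      refine G.symRel_le fun i x hx j y hy => ?_
      refine LinearMap.mem_ker.2 (G.hom_ext fun k z hz => ?_)
      have : G.cubeMk
          (z ⊗ₜ[ℚ] (x ⊗ₜ[ℚ] y) - ((-1 : ℚ) ^ (i * j)) • (z ⊗ₜ[ℚ] (y ⊗ₜ[ℚ] x))) = 0 := by
        rw [← LinearMap.mem_ker, G.ker_cubeMk]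
        exact Submodule.subset_span (Or.inr ⟨i, j, x, hx, y, hy, k, z, hz, rfl⟩)
      simpa [TensorProduct.tmul_sub] using this)))

theorem symMul_tmul (G : Grading V) (x y z : V) :
    G.symMul (x ⊗ₜ G.symMk (y ⊗ₜ z)) = G.cubeMk (x ⊗ₜ (y ⊗ₜ z)) := rfl

/-- The map `𝔪 : V ⊗ 𝒜²𝒢²V → 𝒢³V ⊗ 𝒢²V`,
`q ⊗ (e ∧ f) ↦ qe ⊗ f - (-1)^(|e||f|) qf ⊗ e`. -/
def pent (G : Grading V) : V ⊗[ℚ] G.symSq.AltSq →ₗ[ℚ] G.SymCube ⊗[ℚ] G.SymSq :=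
  G.symMul.rTensor G.SymSq ∘ₗ (TensorProduct.assoc ℚ V G.SymSq G.SymSq).symm.toLinearMap ∘ₗ
    G.symSq.altIncl.lTensor V

theorem pent_tmul (G : Grading V) (q : V) {i j : ℤ} {e f : G.SymSq}
    (he : e ∈ G.symSq.deg i) (hf : f ∈ G.symSq.deg j) :
    G.pent (q ⊗ₜ G.symSq.altMk (e ⊗ₜ f)) =
      G.symMul (q ⊗ₜ e) ⊗ₜ f - ((-1 : ℚ) ^ (i * j)) • (G.symMul (q ⊗ₜ f) ⊗ₜ[ℚ] e) := by
  simp only [pent, LinearMap.comp_apply, LinearMap.lTensor_tmul, G.symSq.altIncl_mk he hf]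
  simp [TensorProduct.tmul_sub]

/-- The map `𝒜²V → 𝒜²W` induced by a map `V → W` of degree `0`. -/
def altMap {G : Grading V} {G' : Grading W} (f : V →ₗ[ℚ] W) (hf : f ∈ G.homs G' 0) :
    G.AltSq →ₗ[ℚ] G'.AltSq :=
  G.altLift (G'.altMk ∘ₗ TensorProduct.map f f) (by
    refine G.altRel_le fun i x hx j y hy => ?_
    rw [LinearMap.mem_ker, LinearMap.comp_apply, ← LinearMap.mem_ker, G'.ker_altMk]
    have h1 := hf _ _ hx
    have h2 := hf _ _ hy
    rw [add_zero] at h1 h2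
    exact Submodule.subset_span ⟨i, j, f x, h1, f y, h2, by simp⟩)

theorem altIncl_mem (G : Grading V) : G.altIncl ∈ G.altSq.homs (G.tensor G) 0 := by
  refine mem_homs_quot (mem_homs_tensor fun i x hx j y hy => ?_)
  rw [LinearMap.comp_apply, G.altIncl_mk hx hy, add_zero]
  refine sub_mem (G.tmul_mem G hx hy) (Submodule.smul_mem _ _ ?_)
  rw [add_comm]; exact G.tmul_mem G hy hx

theorem symMul_mem (G : Grading V) : G.symMul ∈ (G.tensor G.symSq).homs G.symCube 0 := by
  refine mem_homs_tensor fun i x hx j y hy => ?_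
  obtain ⟨y, hy, rfl⟩ := hy
  rw [add_zero]
  have h : x ⊗ₜ[ℚ] y ∈ (G.tensor (G.tensor G)).deg (i + j) := G.tmul_mem _ hx hy
  have h2 : ∀ y, G.symMul (x ⊗ₜ G.symMk y) = G.cubeMk (x ⊗ₜ y) := fun _ => rfl
  rw [h2]
  exact ⟨_, h, rfl⟩

theorem pent_mem (G : Grading V) :
    G.pent ∈ (G.tensor G.symSq.altSq).homs (G.symCube.tensor G.symSq) 0 :=
  homs_comp (rTensor_mem _ G.symMul_mem) (homs_comp (assoc_symm_mem _ _ _)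
    (lTensor_mem _ G.symSq.altIncl_mem) (add_zero 0)) (add_zero 0)

theorem altMap_mem {G : Grading V} {G' : Grading W} {f : V →ₗ[ℚ] W} (hf : f ∈ G.homs G' 0) :
    altMap f hf ∈ G.altSq.homs G'.altSq 0 := by
  refine mem_homs_quot (mem_homs_tensor fun i x hx j y hy => ?_)
  have h1 := hf _ _ hx
  have h2 := hf _ _ hy
  rw [add_zero] at h1 h2 ⊢
  exact ⟨f x ⊗ₜ f y, G'.tmul_mem G' h1 h2, rfl⟩

section Sub

variable (G : Grading V) (G' : Grading W) (ι : W →ₗ[ℚ] G.SymSq)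
  (hι : ι ∈ G'.homs G.symSq 0)

/-- The full symmetrisation map `V ⊗ W → 𝒢³V` for a space `W` mapped to `𝒢²V` by `ι`. -/
def symmetrise : V ⊗[ℚ] W →ₗ[ℚ] G.SymCube := G.symMul ∘ₗ ι.lTensor V

theorem symmetrise_tmul (x : V) (e : W) : G.symmetrise ι (x ⊗ₜ e) = G.symMul (x ⊗ₜ ι e) := rfl

theorem symmetrise_mem (hι : ι ∈ G'.homs G.symSq 0) : G.symmetrise ι ∈ (G.tensor G').homs G.symCube 0 :=
  homs_comp G.symMul_mem (lTensor_mem _ hι) (add_zero 0)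

/-- The restriction of `𝔪 : V ⊗ 𝒜²𝒢²V → 𝒢³V ⊗ 𝒢²V` to `V ⊗ 𝒜²W`, for `ι : W → 𝒢²V`. -/
def pentSub : V ⊗[ℚ] G'.AltSq →ₗ[ℚ] G.SymCube ⊗[ℚ] G.SymSq :=
  G.pent ∘ₗ (altMap ι hι).lTensor V

theorem pentSub_mem : G.pentSub G' ι hι ∈
    (G.tensor G'.altSq).homs (G.symCube.tensor G.symSq) 0 :=
  homs_comp G.pent_mem (lTensor_mem _ (altMap_mem hι)) (add_zero 0)

/-- The map `Id j : V ⊗ 𝒜²W → (V ⊗ W) ⊗ W`. -/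
def idj : V ⊗[ℚ] G'.AltSq →ₗ[ℚ] (V ⊗[ℚ] W) ⊗[ℚ] W :=
  (TensorProduct.assoc ℚ V W W).symm.toLinearMap ∘ₗ G'.altIncl.lTensor V

theorem idj_mem :
    idj (V := V) G' ∈ (G.tensor G'.altSq).homs ((G.tensor G').tensor G') 0 :=
  homs_comp (assoc_symm_mem _ _ _) (lTensor_mem _ G'.altIncl_mem) (add_zero 0)

theorem idj_tmul (q : V) {i j : ℤ} {e f : W} (he : e ∈ G'.deg i) (hf : f ∈ G'.deg j) :
    idj G' (q ⊗ₜ G'.altMk (e ⊗ₜ f)) =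
      (q ⊗ₜ e) ⊗ₜ f - ((-1 : ℚ) ^ (i * j)) • ((q ⊗ₜ[ℚ] f) ⊗ₜ[ℚ] e) := by
  simp only [idj, LinearMap.comp_apply, LinearMap.lTensor_tmul, altIncl_mk _ he hf]
  simp [TensorProduct.tmul_sub]

theorem lTensor_symmetrise_idj (x : V ⊗[ℚ] G'.AltSq) :
    ι.lTensor G.SymCube ((G.symmetrise ι).rTensor W (idj G' x)) = G.pentSub G' ι hι x := by
  have : ι.lTensor G.SymCube ∘ₗ (G.symmetrise ι).rTensor W ∘ₗ idj G' = G.pentSub G' ι hι := by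
    refine TensorProduct.ext (LinearMap.ext fun q => ?_)
    refine G'.altSq_ext fun i e he j f hf => ?_
    have h1 : G.pentSub G' ι hι (q ⊗ₜ G'.altMk (e ⊗ₜ f)) =
        G.pent (q ⊗ₜ G.symSq.altMk (ι e ⊗ₜ ι f)) := rfl
    have h2 := hι _ _ he
    have h3 := hι _ _ hf
    rw [add_zero] at h2 h3
    show ι.lTensor G.SymCube ((G.symmetrise ι).rTensor W
      (idj G' (q ⊗ₜ G'.altMk (e ⊗ₜ f)))) = _
    rw [idj_tmul G' q he hf]
    refine Eq.trans ?_ (h1.trans (G.pent_tmul q h2 h3)).symm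
    simp [symmetrise]
  exact LinearMap.congr_fun this x

/-- `Id j` maps the kernel of `𝔪` to the kernel of the symmetrisation map. -/
theorem symmetrise_idj (hinj : Function.Injective ι) {x : V ⊗[ℚ] G'.AltSq}
    (hx : G.pentSub G' ι hι x = 0) : (G.symmetrise ι).rTensor W (idj G' x) = 0 := by
  have h := G.lTensor_symmetrise_idj G' ι hι x
  rw [hx] at h
  refine (Module.Flat.lTensor_preserves_injective_linearMap (M := G.SymCube) ι hinj) ?_
  rw [h, map_zero]

end Sub

/-- The kernel of a linear map, as a vector space. -/
def Ker (f : V →ₗ[ℚ] W) := LinearMap.ker f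

instance (f : V →ₗ[ℚ] W) : AddCommGroup (Ker f) := inferInstanceAs (AddCommGroup (LinearMap.ker f))

instance (f : V →ₗ[ℚ] W) : Module ℚ (Ker f) := inferInstanceAs (Module ℚ (LinearMap.ker f))

/-- The inclusion of the kernel. -/
def kerIncl (f : V →ₗ[ℚ] W) : Ker f →ₗ[ℚ] V := (LinearMap.ker f).subtype

theorem kerIncl_injective (f : V →ₗ[ℚ] W) : Function.Injective (kerIncl f) :=
  (LinearMap.ker f).injective_subtype

theorem apply_kerIncl (f : V →ₗ[ℚ] W) (x : Ker f) : f (kerIncl f x) = 0 := LinearMap.mem_ker.1 x.2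

/-- The grading of the kernel of a map of degree `0`: `(ker f)ⁿ = ker f ∩ Vⁿ`. -/
def ker {G : Grading V} {G' : Grading W} (f : V →ₗ[ℚ] W) (hf : f ∈ G.homs G' 0) :
    Grading (Ker f) :=
  G.sub (LinearMap.ker f) (isHomogeneous_ker hf)

theorem kerIncl_mem {G : Grading V} {G' : Grading W} (f : V →ₗ[ℚ] W) (hf : f ∈ G.homs G' 0) :
    kerIncl f ∈ (ker f hf).homs G 0 := subtype_mem _ _ _

theorem rTensor_kerIncl_injective (f : V →ₗ[ℚ] W) :
    Function.Injective ((kerIncl f).rTensor U) :=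
  Module.Flat.rTensor_preserves_injective_linearMap _ (kerIncl_injective f)

theorem mem_range_rTensor_kerIncl (f : V →ₗ[ℚ] U) {x : V ⊗[ℚ] W} (hx : f.rTensor W x = 0) :
    x ∈ LinearMap.range ((kerIncl f).rTensor W) := by
  have hex : Function.Exact (LinearMap.ker f).subtype f := by
    rw [LinearMap.exact_iff]; simp
  exact (Module.Flat.rTensor_exact W hex _).1 hx

/-! Products of algebra-valued maps. In each case `s` is the degree of the second factor. -/

section Products

variable {R : Type*} [Ring R] [Algebra ℚ R]

/-- The product `fg : V ⊗ W → R`, `x ⊗ y ↦ (-1)^(s|x|) f(x) g(y)`, for `g` of degree `s`. -/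
def mulMap (G : Grading V) (s : ℤ) (f : V →ₗ[ℚ] R) (g : W →ₗ[ℚ] R) : V ⊗[ℚ] W →ₗ[ℚ] R :=
  LinearMap.mul' ℚ R ∘ₗ TensorProduct.map (f ∘ₗ G.twist s) g

theorem mulMap_tmul (G : Grading V) (s : ℤ) (f : V →ₗ[ℚ] R) (g : W →ₗ[ℚ] R) {i : ℤ} {x : V}
    (hx : x ∈ G.deg i) (y : W) :
    G.mulMap s f g (x ⊗ₜ y) = ((-1 : ℚ) ^ (s * i)) • (f x * g y) := by
  simp [mulMap, G.twist_of_mem s hx]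

/-- The graded symmetric product `fg : 𝒢²V → R`,
`xy ↦ (-1)^(s|x|) f(x) g(y) + (-1)^(s|y| + |x||y|) f(y) g(x)`, for `g` of degree `s`. -/
def symProd (G : Grading V) (s : ℤ) (f g : V →ₗ[ℚ] R) : G.SymSq →ₗ[ℚ] R :=
  G.symLift (G.mulMap s f g ∘ₗ (LinearMap.id + G.swap)) (by
    refine G.symRel_le fun i x hx j y hy => ?_
    have : (LinearMap.id + G.swap : V ⊗[ℚ] V →ₗ[ℚ] V ⊗[ℚ] V) (x ⊗ₜ[ℚ] y -
        ((-1 : ℚ) ^ (i * j)) • (y ⊗ₜ[ℚ] x)) = 0 := by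
      simp only [map_sub, map_smul, LinearMap.add_apply,
        LinearMap.id_apply, G.swap_tmul hx hy, G.swap_tmul hy hx, smul_add, smul_smul,
        mul_comm j i, neg_one_zpow_sq, one_smul]
      abel
    simp only [LinearMap.mem_ker, LinearMap.comp_apply, this, map_zero])

theorem symProd_mk (G : Grading V) (s : ℤ) (f g : V →ₗ[ℚ] R) {i j : ℤ} {x y : V}
    (hx : x ∈ G.deg i) (hy : y ∈ G.deg j) :
    G.symProd s f g (G.symMk (x ⊗ₜ y)) =
      ((-1 : ℚ) ^ (s * i)) • (f x * g y) + ((-1 : ℚ) ^ (s * j + i * j)) • (f y * g x) := by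
  have : (-1 : ℚ) ^ (s * j + i * j) = (-1 : ℚ) ^ (i * j) * (-1 : ℚ) ^ (s * j) := by
    rw [zpow_add₀ (by norm_num), mul_comm]
  rw [symProd, G.symLift_mk, LinearMap.comp_apply,
    LinearMap.add_apply, LinearMap.id_apply, G.swap_tmul hx hy, map_add, map_smul,
    G.mulMap_tmul s f g hx, G.mulMap_tmul s f g hy, smul_smul, this]

/-- The graded antisymmetric product `f ∧ g : 𝒜²V → R`,
`x ∧ y ↦ (-1)^(s|x|) f(x) g(y) - (-1)^(s|y| + |x||y|) f(y) g(x)`, for `g` of degree `s`. -/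
def wedge (G : Grading V) (s : ℤ) (f g : V →ₗ[ℚ] R) : G.AltSq →ₗ[ℚ] R :=
  G.mulMap s f g ∘ₗ G.altIncl

theorem wedge_mk (G : Grading V) (s : ℤ) (f g : V →ₗ[ℚ] R) {i j : ℤ} {x y : V}
    (hx : x ∈ G.deg i) (hy : y ∈ G.deg j) :
    G.wedge s f g (G.altMk (x ⊗ₜ y)) =
      ((-1 : ℚ) ^ (s * i)) • (f x * g y) - ((-1 : ℚ) ^ (s * j + i * j)) • (f y * g x) := by
  have : (-1 : ℚ) ^ (s * j + i * j) = (-1 : ℚ) ^ (i * j) * (-1 : ℚ) ^ (s * j) := by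
    rw [zpow_add₀ (by norm_num), mul_comm]
  simp only [wedge, LinearMap.comp_apply, G.altIncl_mk hx hy]
  simp [G.mulMap_tmul s f g hx, G.mulMap_tmul s f g hy, smul_smul, this]

/-- `f² = ½ ff : 𝒢²V → R` for `f` of degree `0`. -/
def symSquare (G : Grading V) (f : V →ₗ[ℚ] R) : G.SymSq →ₗ[ℚ] R :=
  (2⁻¹ : ℚ) • G.symProd 0 f f

/-- `g² = ½ g ∧ g : 𝒜²V → R` for `g` of degree `-1`. -/
def altSquare (G : Grading V) (g : V →ₗ[ℚ] R) : G.AltSq →ₗ[ℚ] R :=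
  (2⁻¹ : ℚ) • G.wedge (-1) g g

theorem mulMap_mem {G : Grading V} {G' : Grading W} {GR : Grading R}
    (hR : ∀ i j, ∀ a ∈ GR.deg i, ∀ b ∈ GR.deg j, a * b ∈ GR.deg (i + j)) {r s k : ℤ}
    {f : V →ₗ[ℚ] R} {g : W →ₗ[ℚ] R} (hf : f ∈ G.homs GR r) (hg : g ∈ G'.homs GR s)
    (hk : r + s = k) : G.mulMap s f g ∈ (G.tensor G').homs GR k := by
  subst hk
  refine mem_homs_tensor fun i x hx j y hy => ?_
  rw [G.mulMap_tmul s f g hx, show i + j + (r + s) = (i + r) + (j + s) by ring]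
  exact Submodule.smul_mem _ _ (hR _ _ _ (hf _ _ hx) _ (hg _ _ hy))

theorem symProd_mem {G : Grading V} {GR : Grading R}
    (hR : ∀ i j, ∀ a ∈ GR.deg i, ∀ b ∈ GR.deg j, a * b ∈ GR.deg (i + j)) {r s k : ℤ}
    {f : V →ₗ[ℚ] R} {g : V →ₗ[ℚ] R} (hf : f ∈ G.homs GR r) (hg : g ∈ G.homs GR s)
    (hk : r + s = k) : G.symProd s f g ∈ G.symSq.homs GR k := by
  refine mem_homs_quot (mem_homs_tensor fun i x hx j y hy => ?_)
  have h := mulMap_mem hR hf hg hk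
  rw [LinearMap.comp_apply, G.symProd_mk s f g hx hy, ← G.mulMap_tmul s f g hx]
  refine add_mem (h _ _ (G.tmul_mem G hx hy)) (Submodule.smul_mem _ _ ?_)
  subst hk
  rw [show i + j + (r + s) = (j + r) + (i + s) by ring]
  exact hR _ _ _ (hf _ _ hy) _ (hg _ _ hx)

theorem wedge_mem {G : Grading V} {GR : Grading R}
    (hR : ∀ i j, ∀ a ∈ GR.deg i, ∀ b ∈ GR.deg j, a * b ∈ GR.deg (i + j)) {r s k : ℤ}
    {f : V →ₗ[ℚ] R} {g : V →ₗ[ℚ] R} (hf : f ∈ G.homs GR r) (hg : g ∈ G.homs GR s)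
    (hk : r + s = k) : G.wedge s f g ∈ G.altSq.homs GR k :=
  homs_comp (mulMap_mem hR hf hg hk) G.altIncl_mem (zero_add k)

theorem altSquare_mem {G : Grading V} {GR : Grading R}
    (hR : ∀ i j, ∀ a ∈ GR.deg i, ∀ b ∈ GR.deg j, a * b ∈ GR.deg (i + j))
    {g : V →ₗ[ℚ] R} (hg : g ∈ G.homs GR (-1)) : G.altSquare g ∈ G.altSq.homs GR (-2) :=
  Submodule.smul_mem _ _ (wedge_mem hR hg hg (by norm_num))

theorem symProd_add_right (G : Grading V) (s : ℤ) (f g g' : V →ₗ[ℚ] R) :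
    G.symProd s f (g + g') = G.symProd s f g + G.symProd s f g' := by
  refine G.symSq_ext fun i x hx j y hy => ?_
  simp only [LinearMap.add_apply, G.symProd_mk s _ _ hx hy, mul_add, smul_add]
  abel

theorem symProd_smul_right (G : Grading V) (s : ℤ) (f g : V →ₗ[ℚ] R) (a : ℚ) :
    G.symProd s f (a • g) = a • G.symProd s f g := by
  refine G.symSq_ext fun i x hx j y hy => ?_
  simp only [LinearMap.smul_apply, G.symProd_mk s _ _ hx hy, mul_smul_comm, smul_add,
    smul_comm a]

theorem neg_one_zpow_congr {m n : ℤ} (h : Even (m - n)) : (-1 : ℚ) ^ m = (-1 : ℚ) ^ n := by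
  rw [← sub_add_cancel m n, zpow_add₀ (by norm_num), h.neg_one_zpow, one_mul]

theorem neg_one_zpow_congr' {m n : ℤ} (h : Odd (m - n)) : (-1 : ℚ) ^ m = -(-1 : ℚ) ^ n := by
  rw [← sub_add_cancel m n, zpow_add₀ (by norm_num), h.neg_one_zpow, neg_one_mul]

/-- For commuting values, `f² : xy ↦ f(x) f(y)`. -/
theorem symSquare_mk (G : Grading V) {GR : Grading R}
    (hc : ∀ i, ∀ a ∈ GR.deg i, ∀ j, ∀ b ∈ GR.deg j, a * b = ((-1 : ℚ) ^ (i * j)) • (b * a))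
    {f : V →ₗ[ℚ] R} (hf : f ∈ G.homs GR 0) (z : V ⊗[ℚ] V) :
    G.symSquare f (G.symMk z) = LinearMap.mul' ℚ R (TensorProduct.map f f z) := by
  have : G.symSquare f ∘ₗ G.symMk = LinearMap.mul' ℚ R ∘ₗ TensorProduct.map f f := by
    refine G.tensor_ext G fun i x hx j y hy => ?_
    have h1 := hf _ _ hx
    have h2 := hf _ _ hy
    rw [add_zero] at h1 h2
    simp only [LinearMap.comp_apply, symSquare, LinearMap.smul_apply, G.symProd_mk 0 f f hx hy,
      TensorProduct.map_tmul, LinearMap.mul'_apply, zero_mul, zpow_zero, one_smul, zero_add]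
    rw [hc _ _ h1 _ _ h2, ← two_smul ℚ, smul_smul]
    norm_num
  exact LinearMap.congr_fun this z

/-- For commuting values, `g² : x ∧ y ↦ (-1)^|x| g(x) g(y)`. -/
theorem altSquare_mk (G : Grading V) {GR : Grading R}
    (hc : ∀ i, ∀ a ∈ GR.deg i, ∀ j, ∀ b ∈ GR.deg j, a * b = ((-1 : ℚ) ^ (i * j)) • (b * a))
    {g : V →ₗ[ℚ] R} (hg : g ∈ G.homs GR (-1)) {i j : ℤ} {x y : V}
    (hx : x ∈ G.deg i) (hy : y ∈ G.deg j) :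
    G.altSquare g (G.altMk (x ⊗ₜ y)) = ((-1 : ℚ) ^ i) • (g x * g y) := by
  rw [altSquare, LinearMap.smul_apply, G.wedge_mk _ _ _ hx hy,
    hc _ _ (hg _ _ hy) _ _ (hg _ _ hx), smul_smul, ← zpow_add₀ (by norm_num),
    neg_one_zpow_congr' (m := -1 * j + i * j + (j + -1) * (i + -1)) (n := i),
    neg_one_zpow_congr (m := -1 * i) (n := i), neg_smul, sub_neg_eq_add, ← two_smul ℚ,
    smul_smul]
  · norm_num
  · exact ⟨-i, by ring⟩
  · exact ⟨i * j - j - i, by ring⟩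

end Products

end Grading

/-- A graded commutative differential graded algebra over `ℚ`, with differential of degree `+1`. -/
structure CDGA where
  /-- the underlying (total) algebra -/
  A : Type u
  [ring : Ring A]
  [algebra : Algebra ℚ A]
  /-- the homogeneous parts `Aⁿ` -/
  part : ℤ → Submodule ℚ A
  [graded : GradedAlgebra part]
  /-- the differential -/
  d : A →ₗ[ℚ] A
  d_mem : ∀ i, ∀ a ∈ part i, d a ∈ part (i + 1)
  d_d : ∀ a, d (d a) = 0
  leibniz : ∀ i, ∀ a ∈ part i, ∀ b, d (a * b) = d a * b + ((-1 : ℚ) ^ i) • (a * d b)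
  comm : ∀ i, ∀ a ∈ part i, ∀ j, ∀ b ∈ part j, a * b = ((-1 : ℚ) ^ (i * j)) • (b * a)

namespace CDGA

attribute [instance] CDGA.ring CDGA.algebra CDGA.graded

variable (M : CDGA.{u})

/-- The grading of the algebra. -/
def gr : Grading M.A where
  deg := M.part
  isInternal := DirectSum.Decomposition.isInternal M.part

theorem mul_mem {i j : ℤ} {a b : M.A} (ha : a ∈ M.gr.deg i) (hb : b ∈ M.gr.deg j) :
    a * b ∈ M.gr.deg (i + j) :=
  SetLike.mul_mem_graded (A := M.part) ha hb

theorem one_mem : (1 : M.A) ∈ M.gr.deg 0 := SetLike.one_mem_graded M.part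

theorem d_homs : M.d ∈ M.gr.homs M.gr 1 := M.d_mem

theorem leibniz' (a b : M.A) : M.d (a * b) = M.d a * b + M.gr.twist 1 a * M.d b := by
  have : M.d ∘ₗ (LinearMap.mul ℚ M.A).flip b =
      (LinearMap.mul ℚ M.A).flip b ∘ₗ M.d +
        (LinearMap.mul ℚ M.A).flip (M.d b) ∘ₗ M.gr.twist 1 := by
    refine M.gr.hom_ext fun i x hx => ?_
    simp [M.leibniz i x hx, M.gr.twist_of_mem 1 hx]
  exact LinearMap.congr_fun this a

theorem d_twist (a : M.A) : M.d (M.gr.twist 1 a) = - M.gr.twist 1 (M.d a) := by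
  have : M.d ∘ₗ M.gr.twist 1 = - (M.gr.twist 1 ∘ₗ M.d) := by
    refine M.gr.hom_ext fun i x hx => ?_
    simp [M.gr.twist_of_mem 1 hx, M.gr.twist_of_mem 1 (M.d_mem i x hx), zpow_add₀]
  exact LinearMap.congr_fun this a

theorem twist_twist (a : M.A) : M.gr.twist 1 (M.gr.twist 1 a) = a := by
  have : M.gr.twist 1 ∘ₗ M.gr.twist 1 = LinearMap.id := by
    refine M.gr.hom_ext fun i x hx => ?_
    simp [M.gr.twist_of_mem 1 hx, smul_smul, Grading.neg_one_zpow_sq]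
  exact LinearMap.congr_fun this a

theorem d_one : M.d 1 = 0 := by
  have := M.leibniz 0 1 M.one_mem 1
  simpa using this

/-- The subalgebra `Z` of closed elements. -/
def Z : Subalgebra ℚ M.A where
  carrier := {a | M.d a = 0}
  mul_mem' {a b} ha hb := by
    have ha' : M.d a = 0 := ha
    have hb' : M.d b = 0 := hb
    show M.d (a * b) = 0
    rw [M.leibniz', ha', hb']; simp
  add_mem' {a b} ha hb := by
    have ha' : M.d a = 0 := ha
    have hb' : M.d b = 0 := hb
    show M.d (a + b) = 0
    rw [map_add, ha', hb', add_zero]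
  algebraMap_mem' r := by
    show M.d (algebraMap ℚ M.A r) = 0
    rw [Algebra.algebraMap_eq_smul_one, map_smul, M.d_one, smul_zero]

theorem mem_Z {a : M.A} : a ∈ M.Z ↔ M.d a = 0 := Iff.rfl

/-- The ideal of exact elements in `Z`. -/
def B : Ideal M.Z where
  carrier := {z | ∃ a, M.d a = z}
  add_mem' := by
    rintro z w ⟨a, ha⟩ ⟨b, hb⟩
    exact ⟨a + b, by simp [ha, hb]⟩
  zero_mem' := ⟨0, by simp⟩
  smul_mem' := by
    rintro z w ⟨a, ha⟩
    refine ⟨M.gr.twist 1 z * a, ?_⟩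
    rw [M.leibniz', M.d_twist, M.twist_twist, (M.mem_Z.1 z.2), ha]
    simp

theorem mem_B {z : M.Z} : z ∈ M.B ↔ ∃ a, M.d a = z := Iff.rfl

instance : M.B.IsTwoSided where
  mul_mem_of_left := by
    rintro z w ⟨a, ha⟩
    refine ⟨a * w, ?_⟩
    rw [M.leibniz', (M.mem_Z.1 w.2), ha]
    simp

/-- The cohomology algebra `H = Z / B`. -/
def H : Type u := M.Z ⧸ M.B

instance : Ring M.H := inferInstanceAs (Ring (M.Z ⧸ M.B))

instance : Algebra ℚ M.H := inferInstanceAs (Algebra ℚ (M.Z ⧸ M.B))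

/-- The class of a closed element, as a map from `Z` seen as a subspace. -/
def cls : Subalgebra.toSubmodule M.Z →ₗ[ℚ] M.H :=
  (Ideal.Quotient.mkₐ ℚ M.B).toLinearMap ∘ₗ (Subalgebra.toSubmoduleEquiv M.Z).toLinearMap

theorem cls_surjective : Function.Surjective M.cls := by
  intro h
  obtain ⟨z, rfl⟩ := Ideal.Quotient.mk_surjective h
  exact ⟨z, rfl⟩

theorem cls_eq_zero {z : Subalgebra.toSubmodule M.Z} : M.cls z = 0 ↔ ∃ a, M.d a = z :=
  Ideal.Quotient.eq_zero_iff_mem.trans Iff.rfl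

theorem Z_homogeneous : M.gr.IsHomogeneous (Subalgebra.toSubmodule M.Z) :=
  Grading.isHomogeneous_ker M.d_homs

/-- The grading of the space of closed elements. -/
def zgr : Grading (Subalgebra.toSubmodule M.Z) := M.gr.sub _ M.Z_homogeneous

theorem cls_homogeneous : M.zgr.IsHomogeneous (LinearMap.ker M.cls) := by
  intro i z hz
  rw [LinearMap.mem_ker, cls_eq_zero] at hz ⊢
  obtain ⟨a, ha⟩ := hz
  refine ⟨M.gr.proj (i - 1) a, ?_⟩
  rw [← Grading.proj_comm M.d_homs, sub_add_cancel, ha]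
  have := Grading.proj_comm (M.gr.subtype_mem _ M.Z_homogeneous) i z
  rw [add_zero] at this
  exact this

/-- The grading of cohomology: `Hⁿ` consists of the classes of closed elements of `Aⁿ`. -/
def hgr : Grading M.H := M.zgr.quot M.cls M.cls_surjective M.cls_homogeneous

theorem exists_rep {i : ℤ} {x : M.H} (hx : x ∈ M.hgr.deg i) :
    ∃ (a : M.A) (ha : M.d a = 0), a ∈ M.gr.deg i ∧ M.cls ⟨a, ha⟩ = x := by
  obtain ⟨z, hz, rfl⟩ := hx
  exact ⟨z, z.2, hz, rfl⟩

theorem cls_mem {i : ℤ} {a : M.A} (ha : M.d a = 0) (hi : a ∈ M.gr.deg i) :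
    M.cls ⟨a, ha⟩ ∈ M.hgr.deg i := ⟨⟨a, ha⟩, hi, rfl⟩

theorem H_mul_mem {i j : ℤ} {x y : M.H} (hx : x ∈ M.hgr.deg i) (hy : y ∈ M.hgr.deg j) :
    x * y ∈ M.hgr.deg (i + j) := by
  obtain ⟨a, ha, hai, rfl⟩ := M.exists_rep hx
  obtain ⟨b, hb, hbj, rfl⟩ := M.exists_rep hy
  exact M.cls_mem (M.Z.mul_mem ha hb) (M.mul_mem hai hbj)

theorem H_comm {i j : ℤ} {x y : M.H} (hx : x ∈ M.hgr.deg i) (hy : y ∈ M.hgr.deg j) :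
    x * y = ((-1 : ℚ) ^ (i * j)) • (y * x) := by
  obtain ⟨a, ha, hai, rfl⟩ := M.exists_rep hx
  obtain ⟨b, hb, hbj, rfl⟩ := M.exists_rep hy
  have h1 : M.cls ⟨a, ha⟩ * M.cls ⟨b, hb⟩ = M.cls ⟨a * b, M.Z.mul_mem ha hb⟩ := rfl
  have h2 : M.cls ⟨b, hb⟩ * M.cls ⟨a, ha⟩ = M.cls ⟨b * a, M.Z.mul_mem hb ha⟩ := rfl
  rw [h1, h2, ← map_smul]
  congr 1
  exact Subtype.ext (M.comm i a hai j b hbj)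

/-- The map to cohomology induced by a linear map with closed values. -/
def induced {V : Type*} [AddCommGroup V] [Module ℚ V] (f : V →ₗ[ℚ] M.A)
    (hf : ∀ v, M.d (f v) = 0) : V →ₗ[ℚ] M.H :=
  M.cls ∘ₗ f.codRestrict (Subalgebra.toSubmodule M.Z) hf

theorem induced_mem {V : Type*} [AddCommGroup V] [Module ℚ V] {G : Grading V} {k : ℤ}
    {f : V →ₗ[ℚ] M.A} (hf : ∀ v, M.d (f v) = 0) (hk : f ∈ G.homs M.gr k) :
    M.induced f hf ∈ G.homs M.hgr k := fun n x hx => M.cls_mem (hf x) (hk n x hx)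

/-- The product map `𝒢²H → H`. -/
def cup : M.hgr.SymSq →ₗ[ℚ] M.H :=
  M.hgr.symLift (LinearMap.mul' ℚ M.H) (by
    refine M.hgr.symRel_le fun i x hx j y hy => ?_
    simp [M.H_comm hx hy])

theorem cup_mem : M.cup ∈ M.hgr.symSq.homs M.hgr 0 := by
  refine Grading.mem_homs_quot (Grading.mem_homs_tensor fun i x hx j y hy => ?_)
  rw [add_zero]
  exact M.H_mul_mem hx hy

/-- The kernel `E ⊆ 𝒢²H` of the product map. -/
def E : Type u := Grading.Ker M.cup

instance : AddCommGroup M.E := inferInstanceAs (AddCommGroup (Grading.Ker M.cup))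

instance : Module ℚ M.E := inferInstanceAs (Module ℚ (Grading.Ker M.cup))

/-- The inclusion `E → 𝒢²H`. -/
def inclE : M.E →ₗ[ℚ] M.hgr.SymSq := Grading.kerIncl M.cup

theorem inclE_injective : Function.Injective M.inclE := Grading.kerIncl_injective M.cup

theorem cup_inclE (e : M.E) : M.cup (M.inclE e) = 0 := Grading.apply_kerIncl M.cup e

/-- The grading of `E`. -/
def egr : Grading M.E := Grading.ker M.cup M.cup_mem

theorem inclE_mem : M.inclE ∈ M.egr.homs M.hgr.symSq 0 := Grading.kerIncl_mem M.cup M.cup_mem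

/-- The full symmetrisation map `s : H ⊗ E → 𝒢³H`. -/
def s : M.H ⊗[ℚ] M.E →ₗ[ℚ] M.hgr.SymCube := M.hgr.symmetrise M.inclE

theorem s_mem : M.s ∈ (M.hgr.tensor M.egr).homs M.hgr.symCube 0 :=
  M.hgr.symmetrise_mem M.egr M.inclE M.inclE_mem

/-- The kernel `K[H ⊗ E]` of the full symmetrisation map. -/
def K : Type u := Grading.Ker M.s

instance : AddCommGroup M.K := inferInstanceAs (AddCommGroup (Grading.Ker M.s))

instance : Module ℚ M.K := inferInstanceAs (Module ℚ (Grading.Ker M.s))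

/-- The inclusion `K[H ⊗ E] → H ⊗ E`. -/
def inclK : M.K →ₗ[ℚ] M.H ⊗[ℚ] M.E := Grading.kerIncl M.s

theorem s_inclK (k : M.K) : M.s (M.inclK k) = 0 := Grading.apply_kerIncl M.s k

/-- The grading of `K[H ⊗ E]`. -/
def kgr : Grading M.K := Grading.ker M.s M.s_mem

theorem inclK_mem : M.inclK ∈ M.kgr.homs (M.hgr.tensor M.egr) 0 :=
  Grading.kerIncl_mem M.s M.s_mem

/-- The restriction `H ⊗ 𝒜²E → 𝒢³H ⊗ 𝒢²H` of the map `𝔪` to `H ⊗ 𝒜²E`. -/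
def pentE : M.H ⊗[ℚ] M.egr.AltSq →ₗ[ℚ] M.hgr.SymCube ⊗[ℚ] M.hgr.SymSq :=
  M.hgr.pentSub M.egr M.inclE M.inclE_mem

theorem pentE_mem :
    M.pentE ∈ (M.hgr.tensor M.egr.altSq).homs (M.hgr.symCube.tensor M.hgr.symSq) 0 :=
  M.hgr.pentSub_mem M.egr M.inclE M.inclE_mem

/-- The domain `𝒟` of the pentagonal Massey tensor: the kernel of `𝔪` on `H ⊗ 𝒜²E`. -/
def D : Type u := Grading.Ker M.pentE

instance : AddCommGroup M.D := inferInstanceAs (AddCommGroup (Grading.Ker M.pentE))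

instance : Module ℚ M.D := inferInstanceAs (Module ℚ (Grading.Ker M.pentE))

/-- The inclusion `𝒟 → H ⊗ 𝒜²E`. -/
def inclD : M.D →ₗ[ℚ] M.H ⊗[ℚ] M.egr.AltSq := Grading.kerIncl M.pentE

theorem pentE_inclD (x : M.D) : M.pentE (M.inclD x) = 0 := Grading.apply_kerIncl M.pentE x

/-- The grading of `𝒟`. -/
def dgr : Grading M.D := Grading.ker M.pentE M.pentE_mem

theorem inclD_mem : M.inclD ∈ M.dgr.homs (M.hgr.tensor M.egr.altSq) 0 :=
  Grading.kerIncl_mem M.pentE M.pentE_mem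

/-- The map `Id j : H ⊗ 𝒜²E → (H ⊗ E) ⊗ E`. -/
def idj : M.H ⊗[ℚ] M.egr.AltSq →ₗ[ℚ] (M.H ⊗[ℚ] M.E) ⊗[ℚ] M.E := Grading.idj M.egr

theorem s_idj_inclD (x : M.D) : M.s.rTensor M.E (M.idj (M.inclD x)) = 0 :=
  M.hgr.symmetrise_idj M.egr M.inclE M.inclE_mem M.inclE_injective (M.pentE_inclD x)

/-- The inclusion `K[H ⊗ E] ⊗ E → (H ⊗ E) ⊗ E`. -/
def inclKE : M.K ⊗[ℚ] M.E →ₗ[ℚ] (M.H ⊗[ℚ] M.E) ⊗[ℚ] M.E := M.inclK.rTensor M.E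

theorem inclKE_injective : Function.Injective M.inclKE :=
  Grading.rTensor_kerIncl_injective M.s

/-- The image of `𝒟` under `Id j` is contained in `K[H ⊗ E] ⊗ E`. -/
theorem idj_mem_range (x : M.D) : (M.idj ∘ₗ M.inclD) x ∈ LinearMap.range M.inclKE :=
  Grading.mem_range_rTensor_kerIncl M.s (M.s_idj_inclD x)

/-- The map `Id j : 𝒟 → K[H ⊗ E] ⊗ E`. -/
def idjD : M.D →ₗ[ℚ] M.K ⊗[ℚ] M.E :=
  (LinearEquiv.ofInjective M.inclKE M.inclKE_injective).symm.toLinearMap ∘ₗ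
    (M.idj ∘ₗ M.inclD).codRestrict _ M.idj_mem_range

theorem inclKE_idjD (x : M.D) : M.inclKE (M.idjD x) = M.idj (M.inclD x) :=
  congrArg Subtype.val ((LinearEquiv.ofInjective M.inclKE M.inclKE_injective).apply_symm_apply
    ((M.idj ∘ₗ M.inclD).codRestrict _ M.idj_mem_range x))

theorem idjD_mem : M.idjD ∈ M.dgr.homs (M.kgr.tensor M.egr) 0 := by
  intro n x hx
  have hincl : M.inclKE ∈ (M.kgr.tensor M.egr).homs ((M.hgr.tensor M.egr).tensor M.egr) 0 :=
    Grading.rTensor_mem _ M.inclK_mem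
  have h1 : M.inclKE (M.idjD x) ∈ ((M.hgr.tensor M.egr).tensor M.egr).deg (n + 0) := by
    rw [M.inclKE_idjD, ← add_zero (n + 0)]
    exact M.hgr.idj_mem M.egr _ _ (M.inclD_mem n x hx)
  have h2 := Grading.proj_comm hincl n (M.idjD x)
  rw [Grading.proj_same _ h1] at h2
  rw [M.inclKE_injective h2, add_zero]
  exact Grading.proj_mem _ _ _

theorem mul_mem' : ∀ i j, ∀ a ∈ M.gr.deg i, ∀ b ∈ M.gr.deg j, a * b ∈ M.gr.deg (i + j) :=
  fun _ _ _ ha _ hb => M.mul_mem ha hb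

theorem H_mul_mem' : ∀ i j, ∀ a ∈ M.hgr.deg i, ∀ b ∈ M.hgr.deg j, a * b ∈ M.hgr.deg (i + j) :=
  fun _ _ _ ha _ hb => M.H_mul_mem ha hb

/-- A cochain choice `c = (α, γ)`: a right inverse `α` (of degree `0`) of the projection from
closed elements to cohomology, and `γ : E → A` of degree `-1` with `dγ = α²` on `E`. -/
structure Choice where
  /-- representatives of cohomology classes -/
  α : M.H →ₗ[ℚ] M.A
  /-- primitives of the products that are exact -/
  γ : M.E →ₗ[ℚ] M.A
  α_deg : α ∈ M.hgr.homs M.gr 0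
  α_closed : ∀ x, M.d (α x) = 0
  α_class : ∀ x, M.cls ⟨α x, α_closed x⟩ = x
  γ_deg : γ ∈ M.egr.homs M.gr (-1)
  d_γ : ∀ e, M.d (γ e) = M.hgr.symSquare α (M.inclE e)

/-- `L₁`: maps `H → H` of degree `-1`. -/
abbrev L₁ : Submodule ℚ (M.H →ₗ[ℚ] M.H) := M.hgr.homs M.hgr (-1)

/-- `L₂`: maps `E → H` of degree `-1`. -/
def L₂ : Type u := M.egr.homs M.hgr (-1)

instance : AddCommGroup M.L₂ := inferInstanceAs (AddCommGroup (M.egr.homs M.hgr (-1)))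

instance : Module ℚ M.L₂ := inferInstanceAs (Module ℚ (M.egr.homs M.hgr (-1)))

/-- A map `E → H` of degree `-1`, as an element of `L₂`. -/
def L₂.mk (f : M.E →ₗ[ℚ] M.H) (hf : f ∈ M.egr.homs M.hgr (-1)) : M.L₂ := ⟨f, hf⟩

/-- `Id L₁ ⊆ L₂`: the restrictions to `E` of the symmetric products `Id n`, for `n ∈ L₁`. -/
def IdL₁ : Submodule ℚ M.L₂ where
  carrier := {δ | ∃ n ∈ M.L₁, δ.1 = M.hgr.symProd (-1) LinearMap.id n ∘ₗ M.inclE}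
  add_mem' := by
    rintro δ ε ⟨n, hn, hδ⟩ ⟨m, hm, hε⟩
    refine ⟨n + m, add_mem hn hm, ?_⟩
    rw [Grading.symProd_add_right, LinearMap.add_comp, ← hδ, ← hε]; rfl
  zero_mem' := ⟨0, zero_mem _, by
    rw [← zero_smul ℚ (0 : M.H →ₗ[ℚ] M.H), Grading.symProd_smul_right, zero_smul,
      LinearMap.zero_comp]; rfl⟩
  smul_mem' := by
    rintro a δ ⟨n, hn, hδ⟩
    refine ⟨a • n, Submodule.smul_mem _ _ hn, ?_⟩
    rw [Grading.symProd_smul_right, LinearMap.smul_comp, ← hδ]; rfl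

/-- `Hom(𝒟*, H*⁻²)`: maps `𝒟 → H` of degree `-2`. -/
def HomD : Type u := M.dgr.homs M.hgr (-2)

instance : AddCommGroup M.HomD := inferInstanceAs (AddCommGroup (M.dgr.homs M.hgr (-2)))

instance : Module ℚ M.HomD := inferInstanceAs (Module ℚ (M.dgr.homs M.hgr (-2)))

/-- A map `𝒟 → H` of degree `-2`, as an element of `HomD`. -/
def HomD.mk (f : M.D →ₗ[ℚ] M.H) (hf : f ∈ M.dgr.homs M.hgr (-2)) : M.HomD := ⟨f, hf⟩

/-- `Id(δ ∧ ε)` on `𝒟`. -/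
def wedgeTerm (δ ε : M.L₂) : M.HomD :=
  HomD.mk M (M.hgr.mulMap (-2) LinearMap.id (M.egr.wedge (-1) δ.1 ε.1) ∘ₗ M.inclD)
    (Grading.homs_comp
      (Grading.mulMap_mem M.H_mul_mem' (r := 0) (k := -2) (fun n x hx => by rw [add_zero]; exact hx)
        (Grading.wedge_mem M.H_mul_mem' δ.2 ε.2 (by norm_num)) (zero_add _))
      M.inclD_mem (zero_add _))

/-- `Id δ²` on `𝒟`. -/
def squareTerm (δ : M.L₂) : M.HomD :=
  HomD.mk M (M.hgr.mulMap (-2) LinearMap.id (M.egr.altSquare δ.1) ∘ₗ M.inclD)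
    (Grading.homs_comp
      (Grading.mulMap_mem M.H_mul_mem' (r := 0) (k := -2) (fun n x hx => by rw [add_zero]; exact hx)
        (Grading.altSquare_mem M.H_mul_mem' δ.2) (zero_add _))
      M.inclD_mem (zero_add _))

namespace Choice

variable {M} (c : M.Choice)

theorem α_mem {i : ℤ} {x : M.H} (hx : x ∈ M.hgr.deg i) : c.α x ∈ M.gr.deg i := by
  have := c.α_deg i x hx
  rwa [add_zero] at this

theorem α_sq_mk (x y : M.H) :
    M.hgr.symSquare c.α (M.hgr.symMk (x ⊗ₜ y)) = c.α x * c.α y := by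
  rw [M.hgr.symSquare_mk M.comm c.α_deg]; simp

theorem α_sq_mem {i : ℤ} {e : M.hgr.SymSq} (he : e ∈ M.hgr.symSq.deg i) :
    M.hgr.symSquare c.α e ∈ M.gr.deg i := by
  have := Grading.symProd_mem M.mul_mem' c.α_deg c.α_deg (add_zero 0) i e he
  rw [add_zero] at this
  exact Submodule.smul_mem _ _ this

/-- `α³ : 𝒢³H → A`. -/
def cube : M.hgr.SymCube →ₗ[ℚ] M.A :=
  M.hgr.cubeLift (LinearMap.mul' ℚ M.A ∘ₗ
      TensorProduct.map c.α (LinearMap.mul' ℚ M.A ∘ₗ TensorProduct.map c.α c.α)) (by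
    refine Submodule.span_le.2 ?_
    rintro _ (⟨i, j, x, hx, y, hy, k, z, hz, rfl⟩ | ⟨i, j, x, hx, y, hy, k, z, hz, rfl⟩)
    · simp [← mul_assoc, M.comm _ _ (c.α_mem hx) _ _ (c.α_mem hy)]
    · simp [M.comm _ _ (c.α_mem hx) _ _ (c.α_mem hy)])

theorem cube_symMul (x : M.H) (e : M.hgr.SymSq) :
    c.cube (M.hgr.symMul (x ⊗ₜ e)) = c.α x * M.hgr.symSquare c.α e := by
  obtain ⟨z, rfl⟩ := M.hgr.symMk_surjective e
  rw [M.hgr.symSquare_mk M.comm c.α_deg]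
  rfl

theorem d_αγ (z : M.H ⊗[ℚ] M.E) :
    M.d (M.hgr.mulMap (-1) c.α c.γ z) = c.cube (M.s z) := by
  have : M.d ∘ₗ M.hgr.mulMap (-1) c.α c.γ = c.cube ∘ₗ M.s := by
    refine M.hgr.tensor_ext M.egr fun i x hx j e he => ?_
    have h1 : M.s (x ⊗ₜ e) = M.hgr.symMul (x ⊗ₜ M.inclE e) := rfl
    rw [LinearMap.comp_apply, LinearMap.comp_apply, h1, c.cube_symMul,
      M.hgr.mulMap_tmul _ _ _ hx, map_smul, M.leibniz _ _ (c.α_mem hx), c.α_closed, c.d_γ,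
      zero_mul, zero_add, smul_smul, ← zpow_add₀ (by norm_num),
      Grading.neg_one_zpow_congr (n := 0) ⟨0, by ring⟩, zpow_zero, one_smul]
  exact LinearMap.congr_fun this z

/-- The uniform triple product `T_c : K[H ⊗ E] → H`, induced by `αγ`. -/
def T : M.K →ₗ[ℚ] M.H :=
  M.induced (M.hgr.mulMap (-1) c.α c.γ ∘ₗ M.inclK) fun k => by
    rw [LinearMap.comp_apply, c.d_αγ, M.s_inclK, map_zero]

theorem T_mem : c.T ∈ M.kgr.homs M.hgr (-1) :=
  M.induced_mem _ (Grading.homs_comp (Grading.mulMap_mem M.mul_mem' c.α_deg c.γ_deg (zero_add _))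
    M.inclK_mem (zero_add _))

theorem d_αγγ (z : M.H ⊗[ℚ] M.egr.AltSq) :
    M.d (M.hgr.mulMap (-2) c.α (M.egr.altSquare c.γ) z) =
      M.hgr.symCube.mulMap (-1) c.cube c.γ ((M.s).rTensor M.E (M.idj z)) := by
  have : M.d ∘ₗ M.hgr.mulMap (-2) c.α (M.egr.altSquare c.γ) =
      M.hgr.symCube.mulMap (-1) c.cube c.γ ∘ₗ (M.s).rTensor M.E ∘ₗ M.idj := by
    refine TensorProduct.ext (M.hgr.hom_ext fun k x hx => ?_)
    refine M.egr.altSq_ext fun i e he j f hf => ?_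
    show M.d (M.hgr.mulMap (-2) c.α (M.egr.altSquare c.γ) (x ⊗ₜ M.egr.altMk (e ⊗ₜ f))) =
      M.hgr.symCube.mulMap (-1) c.cube c.γ ((M.s).rTensor M.E
        (M.idj (x ⊗ₜ M.egr.altMk (e ⊗ₜ f))))
    have h1 : M.idj (x ⊗ₜ M.egr.altMk (e ⊗ₜ f)) = _ := M.egr.idj_tmul x he hf
    have h2 : ∀ e : M.E, M.s (x ⊗ₜ e) = M.hgr.symMul (x ⊗ₜ M.inclE e) :=
      fun _ => rfl
    have h3 : ∀ {i} {e : M.E}, e ∈ M.egr.deg i →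
        M.hgr.symMul (x ⊗ₜ M.inclE e) ∈ M.hgr.symCube.deg (k + i) := by
      intro i e he
      have := M.hgr.symMul_mem _ _ (M.hgr.tmul_mem M.hgr.symSq hx he)
      rwa [add_zero] at this
    rw [h1, map_sub, map_smul, LinearMap.rTensor_tmul, LinearMap.rTensor_tmul, h2, h2, map_sub,
      map_smul, Grading.mulMap_tmul _ _ _ _ (h3 he), Grading.mulMap_tmul _ _ _ _ (h3 hf),
      M.hgr.mulMap_tmul _ _ _ hx, M.egr.altSquare_mk M.comm c.γ_deg he hf, c.cube_symMul,
      c.cube_symMul]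
    have hf' : M.hgr.symSquare c.α (M.inclE f) ∈ M.gr.deg j := by
      have := M.inclE_mem _ _ hf
      rw [add_zero] at this
      exact c.α_sq_mem this
    rw [map_smul, mul_smul_comm, map_smul, M.leibniz _ _ (c.α_mem hx), c.α_closed, zero_mul,
      zero_add, M.leibniz _ _ (c.γ_deg _ _ he), c.d_γ, c.d_γ,
      M.comm _ _ (c.γ_deg _ _ he) _ _ hf']
    simp only [mul_add, smul_add, mul_smul_comm, smul_smul,
      ← zpow_add₀ (show (-1 : ℚ) ≠ 0 by norm_num), mul_assoc]
    rw [Grading.neg_one_zpow_congr (m := -2 * k + (i + k)) (n := -1 * k + -1 * i) ⟨i, by ring⟩,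
      Grading.neg_one_zpow_congr' (m := -2 * k + (i + (k + (i + -1 + (i + -1) * j))))
        (n := i * j + (-1 * k + -1 * j)) ⟨i - 1, by ring⟩, neg_smul, sub_eq_add_neg]
  exact LinearMap.congr_fun this z

/-- The pentagonal Massey tensor `P_c : 𝒟 → H`, of degree `-2`, induced by `αγ²`. -/
def P : M.HomD :=
  HomD.mk M (M.induced (M.hgr.mulMap (-2) c.α (M.egr.altSquare c.γ) ∘ₗ M.inclD) fun x => by
      rw [LinearMap.comp_apply, c.d_αγγ, M.s_idj_inclD, map_zero])
    (M.induced_mem _ (Grading.homs_comp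
      (Grading.mulMap_mem M.mul_mem' c.α_deg (Grading.altSquare_mem M.mul_mem' c.γ_deg)
        (zero_add _))
      M.inclD_mem (zero_add _)))

/-- `(T_c δ) ∘ (Id j) : 𝒟 → H`, where `T_c δ : K[H ⊗ E] ⊗ E → H`. -/
def tripleTerm (δ : M.L₂) : M.HomD :=
  HomD.mk M (M.kgr.mulMap (-1) c.T δ.1 ∘ₗ M.idjD)
    (Grading.homs_comp (Grading.mulMap_mem M.H_mul_mem' c.T_mem δ.2 rfl) M.idjD_mem (by norm_num))

/-- `β : H → A` of degree `-1` with `dβ = α' - α`. -/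
structure IsHomotopy (c' c : M.Choice) (β : M.H →ₗ[ℚ] M.A) : Prop where
  deg : β ∈ M.hgr.homs M.gr (-1)
  d_eq : ∀ x, M.d (β x) = c'.α x - c.α x

theorem d_symProd (f g : M.H →ₗ[ℚ] M.A) (hg : ∀ x, M.d (g x) = 0) (z : M.hgr.SymSq) :
    M.d (M.hgr.symProd 0 f g z) = M.hgr.symProd 0 (M.d ∘ₗ f) g z := by
  have : M.d ∘ₗ M.hgr.symProd 0 f g = M.hgr.symProd 0 (M.d ∘ₗ f) g := by
    refine M.hgr.symSq_ext fun i x hx j y hy => ?_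
    simp [M.hgr.symProd_mk 0 _ _ hx hy, M.leibniz', hg]
  exact LinearMap.congr_fun this z

/-- `γ' - γ - β(α + ½ dβ) : E → A`. -/
def diffMap (c' c : M.Choice) (β : M.H →ₗ[ℚ] M.A) : M.E →ₗ[ℚ] M.A :=
  c'.γ - c.γ - M.hgr.symProd 0 β (c.α + (2⁻¹ : ℚ) • M.d ∘ₗ β) ∘ₗ M.inclE

theorem d_diffMap {c' c : M.Choice} {β : M.H →ₗ[ℚ] M.A} (h : IsHomotopy c' c β) (e : M.E) :
    M.d (diffMap c' c β e) = 0 := by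
  have key : M.hgr.symProd 0 (M.d ∘ₗ β) (c.α + (2⁻¹ : ℚ) • M.d ∘ₗ β) =
      M.hgr.symSquare c'.α - M.hgr.symSquare c.α := by
    refine M.hgr.symSq_ext fun i x hx j y hy => ?_
    rw [M.hgr.symProd_mk 0 _ _ hx hy, LinearMap.sub_apply, α_sq_mk, α_sq_mk]
    simp only [LinearMap.comp_apply, LinearMap.add_apply, LinearMap.smul_apply, h.d_eq, zero_mul,
      zero_add, zpow_zero, one_smul]
    have e1 : ((-1 : ℚ) ^ (i * j)) • ((c'.α y - c.α y) * (c.α x + (2⁻¹ : ℚ) • (c'.α x - c.α x)))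
        = (c.α x + (2⁻¹ : ℚ) • (c'.α x - c.α x)) * (c'.α y - c.α y) := by
      have hx1 := sub_mem (c'.α_mem hx) (c.α_mem hx)
      exact (M.comm i _ (add_mem (c.α_mem hx) (Submodule.smul_mem _ _ hx1)) j _
        (sub_mem (c'.α_mem hy) (c.α_mem hy))).symm
    rw [e1]
    simp only [mul_add, add_mul, mul_sub, sub_mul, smul_sub, mul_smul_comm, smul_mul_assoc]
    module
  have hcl : ∀ x, M.d ((c.α + (2⁻¹ : ℚ) • M.d ∘ₗ β) x) = 0 := fun x => by
    simp [c.α_closed, M.d_d]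
  simp only [diffMap, LinearMap.sub_apply, LinearMap.comp_apply, map_sub, c'.d_γ, c.d_γ,
    d_symProd _ _ hcl]
  rw [key, LinearMap.sub_apply, sub_self]

theorem diffMap_mem {c' c : M.Choice} {β : M.H →ₗ[ℚ] M.A} (h : IsHomotopy c' c β) :
    diffMap c' c β ∈ M.egr.homs M.gr (-1) := by
  refine sub_mem (sub_mem c'.γ_deg c.γ_deg) (Grading.homs_comp (Grading.symProd_mem M.mul_mem'
    h.deg (add_mem c.α_deg (Submodule.smul_mem _ _ ?_)) (add_zero _)) M.inclE_mem (zero_add _))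
  exact Grading.homs_comp M.d_homs h.deg (by norm_num)

/-- The map `δ(c', c) : E → H` induced by `γ' - γ - β(α + ½ dβ)`, for a given `β`. -/
def delta (c' c : M.Choice) (β : M.H →ₗ[ℚ] M.A) (h : IsHomotopy c' c β) : M.L₂ :=
  L₂.mk M (M.induced (diffMap c' c β) (d_diffMap h)) (M.induced_mem _ (diffMap_mem h))

end Choice

theorem exists_primitive : ∃ p ∈ M.gr.homs M.gr (-1), ∀ b, (∃ a, M.d a = b) → M.d (p b) = b := by
  obtain ⟨g, hg⟩ := LinearMap.exists_rightInverse_of_surjective M.d.rangeRestrict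
    M.d.range_rangeRestrict
  obtain ⟨r, hr⟩ := LinearMap.exists_leftInverse_of_injective (LinearMap.range M.d).subtype
    (LinearMap.range M.d).ker_subtype
  have hs : ∀ b, (∃ a, M.d a = b) → M.d ((g ∘ₗ r) b) = b := by
    rintro b ⟨a, rfl⟩
    have h1 : r (M.d a) = ⟨M.d a, a, rfl⟩ := LinearMap.congr_fun hr ⟨M.d a, a, rfl⟩
    have h2 := LinearMap.congr_fun hg ⟨M.d a, a, rfl⟩
    rw [LinearMap.comp_apply, h1]
    exact congrArg Subtype.val h2
  have hd : ∀ i a, M.d (M.gr.proj (i - 1) a) = M.gr.proj i (M.d a) := fun i a => by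
    rw [← Grading.proj_comm M.d_homs, sub_add_cancel]
  refine ⟨M.gr.lift fun i => M.gr.proj (i - 1) ∘ₗ (g ∘ₗ r) ∘ₗ (M.gr.deg i).subtype, ?_, ?_⟩
  · intro n x hx
    rw [M.gr.lift_of_mem _ hx]
    exact M.gr.proj_mem _ _
  · rintro _ ⟨a, rfl⟩
    have : M.d ∘ₗ M.gr.lift (fun i => M.gr.proj (i - 1) ∘ₗ (g ∘ₗ r) ∘ₗ (M.gr.deg i).subtype) ∘ₗ M.d
        = M.d := by
      refine M.gr.hom_ext fun i x hx => ?_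
      have h1 := M.d_mem i x hx
      simp only [LinearMap.comp_apply]
      rw [M.gr.lift_of_mem _ h1]
      simp only [LinearMap.comp_apply, Submodule.subtype_apply]
      rw [hd]
      have h2 := hs (M.d x) ⟨x, rfl⟩
      simp only [LinearMap.comp_apply] at h2
      rw [h2]
      exact M.gr.proj_same h1
    exact LinearMap.congr_fun this a

theorem cls_sub_eq_zero {a b : M.A} (ha : M.d a = 0) (hb : M.d b = 0)
    (h : M.cls ⟨a, ha⟩ = M.cls ⟨b, hb⟩) : ∃ x, M.d x = a - b := by
  rw [← sub_eq_zero, ← map_sub, M.cls_eq_zero] at h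
  exact h

theorem cls_eq_of_sub {a b x : M.A} (ha : M.d a = 0) (hb : M.d b = 0) (h : M.d x = a - b) :
    M.cls ⟨a, ha⟩ = M.cls ⟨b, hb⟩ := by
  rw [← sub_eq_zero, ← map_sub, M.cls_eq_zero]
  exact ⟨x, h⟩

instance : Nonempty M.Choice := by
  obtain ⟨σ, hσ⟩ := LinearMap.exists_rightInverse_of_surjective M.cls
    (LinearMap.range_eq_top.2 M.cls_surjective)
  let α : M.H →ₗ[ℚ] M.A := M.hgr.lift fun i =>
    (Subalgebra.toSubmodule M.Z).subtype ∘ₗ M.zgr.proj i ∘ₗ σ ∘ₗ (M.hgr.deg i).subtype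
  have hα : ∀ i (x : M.H) (hx : x ∈ M.hgr.deg i), α x = (M.zgr.proj i (σ x) : M.A) :=
    fun i x hx => M.hgr.lift_of_mem _ hx
  have hdeg : α ∈ M.hgr.homs M.gr 0 := by
    intro n x hx
    rw [hα n x hx, add_zero]
    exact M.zgr.proj_mem n (σ x)
  have hcl : ∀ x, M.d (α x) = 0 := by
    intro x
    have : M.d ∘ₗ α = 0 := by
      refine M.hgr.hom_ext fun i x hx => ?_
      rw [LinearMap.comp_apply, hα i x hx]
      exact (M.zgr.proj i (σ x)).2
    exact LinearMap.congr_fun this x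
  have hclass : ∀ x, M.cls ⟨α x, hcl x⟩ = x := by
    intro x
    have : M.induced α hcl = LinearMap.id := by
      refine M.hgr.hom_ext fun i x hx => ?_
      have h1 : M.induced α hcl x = M.cls (M.zgr.proj i (σ x)) :=
        congrArg M.cls (Subtype.ext (hα i x hx))
      rw [h1]
      have hm : M.cls ∈ M.zgr.homs M.hgr 0 := fun n z hz => by
        rw [add_zero]; exact ⟨z, hz, rfl⟩
      have h2 := Grading.proj_comm hm i (σ x)
      rw [← h2, add_zero]
      have h3 : M.cls (σ x) = x := LinearMap.congr_fun hσ x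
      rw [h3, M.hgr.proj_same hx]; rfl
    exact LinearMap.congr_fun this x
  obtain ⟨p, hp, hp'⟩ := M.exists_primitive
  have hsq : M.hgr.symSquare α ∈ M.hgr.symSq.homs M.gr 0 :=
    Submodule.smul_mem _ _ (Grading.symProd_mem M.mul_mem' hdeg hdeg (add_zero 0))
  have hcl2 : ∀ z, M.d (M.hgr.symSquare α z) = 0 := by
    intro z
    have : M.d ∘ₗ M.hgr.symSquare α = 0 := by
      refine M.hgr.symSq_ext fun i x hx j y hy => ?_
      rw [LinearMap.comp_apply, M.hgr.symSquare_mk M.comm hdeg]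
      simp [M.leibniz', hcl]
    exact LinearMap.congr_fun this z
  have hcup : ∀ z, M.cls ⟨M.hgr.symSquare α z, hcl2 z⟩ = M.cup z := by
    intro z
    have : M.induced (M.hgr.symSquare α) hcl2 = M.cup := by
      refine M.hgr.symSq_ext fun i x hx j y hy => ?_
      have h1 : M.cup (M.hgr.symMk (x ⊗ₜ y)) = x * y := rfl
      rw [h1]
      conv_rhs => rw [← hclass x, ← hclass y]
      have h2 : M.cls ⟨α x, hcl x⟩ * M.cls ⟨α y, hcl y⟩ =
        M.cls ⟨α x * α y, M.Z.mul_mem (hcl x) (hcl y)⟩ := rfl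
      rw [h2]
      refine congrArg M.cls (Subtype.ext ?_)
      show M.hgr.symSquare α (M.hgr.symMk (x ⊗ₜ y)) = _
      rw [M.hgr.symSquare_mk M.comm hdeg]; simp
    exact LinearMap.congr_fun this z
  refine ⟨⟨α, p ∘ₗ M.hgr.symSquare α ∘ₗ M.inclE, hdeg, hcl, hclass,
    Grading.homs_comp hp (Grading.homs_comp hsq M.inclE_mem (add_zero 0)) (zero_add _), ?_⟩⟩
  intro e
  refine hp' _ ?_
  have h := hcup (M.inclE e)
  rw [M.cup_inclE, M.cls_eq_zero] at h
  exact h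

namespace Choice

variable {M}

theorem exists_homotopy (c' c : M.Choice) : ∃ β, IsHomotopy c' c β := by
  obtain ⟨p, hp, hp'⟩ := M.exists_primitive
  refine ⟨p ∘ₗ (c'.α - c.α), Grading.homs_comp hp (sub_mem c'.α_deg c.α_deg) (zero_add _),
    fun x => hp' _ ?_⟩
  exact M.cls_sub_eq_zero (c'.α_closed x) (c.α_closed x) ((c'.α_class x).trans (c.α_class x).symm)

end Choice

theorem symProd_zero_left (s : ℤ) (g : M.H →ₗ[ℚ] M.A) : M.hgr.symProd s 0 g = 0 :=
  M.hgr.symSq_ext fun i x hx j y hy => by simp [M.hgr.symProd_mk s _ _ hx hy]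

/-- `d(fg) = (df)g - f(dg)` and `(df)g = g(df)`, for `f` and `g` of degree `-1`. -/
theorem d_symProd_neg {f g : M.H →ₗ[ℚ] M.A} (hf : f ∈ M.hgr.homs M.gr (-1))
    (hg : g ∈ M.hgr.homs M.gr (-1)) (z : M.hgr.SymSq) :
    M.d (M.hgr.symProd (-1) f g z) =
      M.hgr.symProd 0 g (M.d ∘ₗ f) z - M.hgr.symProd 0 f (M.d ∘ₗ g) z := by
  have hd : ∀ {f : M.H →ₗ[ℚ] M.A} (_ : f ∈ M.hgr.homs M.gr (-1)) {i x} (_ : x ∈ M.hgr.deg i),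
      M.d (f x) ∈ M.gr.deg i := fun hf i x hx => by
    have := M.d_mem _ _ (hf i x hx)
    rwa [neg_add_cancel_right] at this
  have : M.d ∘ₗ M.hgr.symProd (-1) f g =
      M.hgr.symProd 0 g (M.d ∘ₗ f) - M.hgr.symProd 0 f (M.d ∘ₗ g) := by
    refine M.hgr.symSq_ext fun i x hx j y hy => ?_
    simp only [LinearMap.comp_apply, LinearMap.sub_apply, M.hgr.symProd_mk _ _ _ hx hy, map_add,
      map_smul, M.leibniz _ _ (hf _ _ hx), M.leibniz _ _ (hf _ _ hy), zero_mul, zpow_zero,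
      one_smul, zero_add]
    rw [M.comm _ _ (hd hf hx) _ _ (hg _ _ hy), M.comm _ _ (hd hf hy) _ _ (hg _ _ hx)]
    simp only [smul_add, smul_smul, ← zpow_add₀ (show (-1 : ℚ) ≠ 0 by norm_num)]
    rw [Grading.neg_one_zpow_congr (m := -1 * i + i * (j + -1)) (n := i * j) ⟨-i, by ring⟩,
      Grading.neg_one_zpow_congr' (m := -1 * i + (i + -1)) (n := 0) ⟨-1, by ring⟩,
      Grading.neg_one_zpow_congr (m := -1 * j + i * j + j * (i + -1)) (n := 0)
        ⟨i * j - j, by ring⟩,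
      Grading.neg_one_zpow_congr' (m := -1 * j + i * j + (j + -1)) (n := i * j) ⟨-1, by ring⟩]
    simp only [zpow_zero, one_smul, neg_smul]
    abel
  exact LinearMap.congr_fun this z

namespace Choice

variable {M}

/-- The product of a closed map `η` of degree `-1` with `α` induces `Id [η]`. -/
theorem cls_symProd (c : M.Choice) {η : M.H →ₗ[ℚ] M.A} (hη : η ∈ M.hgr.homs M.gr (-1))
    (hη' : ∀ x, M.d (η x) = 0) (z : M.hgr.SymSq) (hz : M.d (M.hgr.symProd 0 η c.α z) = 0) :
    M.cls ⟨_, hz⟩ = M.hgr.symProd (-1) LinearMap.id (M.induced η hη') z := by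
  have hcl : ∀ z, M.d (M.hgr.symProd 0 η c.α z) = 0 := fun z => by
    rw [d_symProd _ _ c.α_closed, show M.d ∘ₗ η = 0 from LinearMap.ext hη',
      M.symProd_zero_left, LinearMap.zero_apply]
  have : M.induced (M.hgr.symProd 0 η c.α) hcl =
      M.hgr.symProd (-1) LinearMap.id (M.induced η hη') := by
    refine M.hgr.symSq_ext fun i x hx j y hy => ?_
    have hn := M.induced_mem hη' hη
    have h1 : ∀ x y, M.cls ⟨η x * c.α y, M.Z.mul_mem (hη' x) (c.α_closed y)⟩ =
        M.induced η hη' x * y := fun x y => by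
      conv_rhs => rw [← c.α_class y]
      rfl
    have h2 : M.induced (M.hgr.symProd 0 η c.α) hcl (M.hgr.symMk (x ⊗ₜ y)) =
        M.cls (⟨η x * c.α y, M.Z.mul_mem (hη' x) (c.α_closed y)⟩ +
          ((-1 : ℚ) ^ (i * j)) • ⟨η y * c.α x, M.Z.mul_mem (hη' y) (c.α_closed x)⟩) := by
      refine congrArg M.cls (Subtype.ext ?_)
      show M.hgr.symProd 0 η c.α (M.hgr.symMk (x ⊗ₜ y)) =
        η x * c.α y + ((-1 : ℚ) ^ (i * j)) • (η y * c.α x)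
      rw [M.hgr.symProd_mk 0 _ _ hx hy]; simp
    rw [h2, map_add, map_smul, h1, h1, M.hgr.symProd_mk _ _ _ hx hy, LinearMap.id_apply,
      LinearMap.id_apply, M.H_comm (hn _ _ hx) hy, M.H_comm (hn _ _ hy) hx]
    simp only [smul_smul, ← zpow_add₀ (show (-1 : ℚ) ≠ 0 by norm_num)]
    rw [Grading.neg_one_zpow_congr (m := i * j + (j + -1) * i) (n := -1 * i) ⟨i * j, by ring⟩,
      Grading.neg_one_zpow_congr (m := (i + -1) * j) (n := -1 * j + i * j) ⟨0, by ring⟩, add_comm]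
  exact LinearMap.congr_fun this z

theorem mem_IdL₁ (c : M.Choice) {δ : M.L₂} {η : M.H →ₗ[ℚ] M.A} (hη : η ∈ M.hgr.homs M.gr (-1))
    (hη' : ∀ x, M.d (η x) = 0)
    (h : ∀ e, ∃ (a : M.A) (ha : M.d a = 0), δ.1 e = M.cls ⟨a, ha⟩ ∧
      ∃ b, M.d b = a - M.hgr.symProd 0 η c.α (M.inclE e)) : δ ∈ M.IdL₁ := by
  refine ⟨M.induced η hη', M.induced_mem _ hη, LinearMap.ext fun e => ?_⟩
  obtain ⟨a, ha, h1, b, hb⟩ := h e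
  have hz : M.d (M.hgr.symProd 0 η c.α (M.inclE e)) = 0 := by
    rw [← sub_sub_cancel a (M.hgr.symProd 0 η c.α (M.inclE e)), ← hb, map_sub, ha, M.d_d, sub_zero]
  rw [h1, LinearMap.comp_apply, ← c.cls_symProd hη hη' _ hz]
  exact M.cls_eq_of_sub _ _ hb

/-- The difference `c' - c ∈ L₂ / Id L₁` of two cochain choices: the class of `δ(c', c)`, for any
`β` with `dβ = α' - α` (see `diff_eq`). -/
def diff (c' c : M.Choice) : M.L₂ ⧸ M.IdL₁ :=
  M.IdL₁.mkQ (delta c' c _ (exists_homotopy c' c).choose_spec)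

theorem delta_apply (c' c : M.Choice) (β : M.H →ₗ[ℚ] M.A) (h : IsHomotopy c' c β) (e : M.E) :
    (delta c' c β h).1 e = M.cls ⟨diffMap c' c β e, d_diffMap h e⟩ := rfl

theorem diff_eq (c' c : M.Choice) (β : M.H →ₗ[ℚ] M.A) (h : IsHomotopy c' c β) :
    diff c' c = M.IdL₁.mkQ (delta c' c β h) := by
  have hβ₂ := (exists_homotopy c' c).choose_spec
  unfold diff
  generalize_proofs hh
  clear hβ₂
  generalize hh.choose = β₂ at *
  rename_i h₂
  rw [Submodule.mkQ_apply, Submodule.mkQ_apply, Submodule.Quotient.eq]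
  have hd : M.d ∘ₗ β₂ = M.d ∘ₗ β := LinearMap.ext fun x => (h₂.d_eq x).trans (h.d_eq x).symm
  refine c.mem_IdL₁ (η := β - β₂) (sub_mem h.deg h₂.deg)
    (fun x => by rw [LinearMap.sub_apply, map_sub, h.d_eq, h₂.d_eq, sub_self]) fun e => ?_
  refine ⟨diffMap c' c β₂ e - diffMap c' c β e, by rw [map_sub, d_diffMap h, d_diffMap h₂, sub_self],
    (map_sub M.cls ⟨_, d_diffMap h₂ e⟩ ⟨_, d_diffMap h e⟩).symm, ?_⟩
  have key : M.hgr.symProd 0 β (c.α + (2⁻¹ : ℚ) • M.d ∘ₗ β) -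
      M.hgr.symProd 0 β₂ (c.α + (2⁻¹ : ℚ) • M.d ∘ₗ β) - M.hgr.symProd 0 (β - β₂) c.α =
      (2⁻¹ : ℚ) • M.hgr.symProd 0 (β - β₂) (M.d ∘ₗ β) := by
    refine M.hgr.symSq_ext fun i x hx j y hy => ?_
    simp only [LinearMap.sub_apply, LinearMap.smul_apply, M.hgr.symProd_mk _ _ _ hx hy,
      LinearMap.add_apply, mul_add, sub_mul, mul_smul_comm]
    module
  refine ⟨(-2⁻¹ : ℚ) • M.hgr.symProd (-1) (β - β₂) β (M.inclE e), ?_⟩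
  rw [map_smul, M.d_symProd_neg (sub_mem h.deg h₂.deg) h.deg, LinearMap.comp_sub, hd, sub_self]
  have h0 : M.hgr.symProd 0 β (0 : M.H →ₗ[ℚ] M.A) = 0 :=
    M.hgr.symSq_ext fun i x hx j y hy => by simp [M.hgr.symProd_mk 0 _ _ hx hy]
  have k := LinearMap.congr_fun key (M.inclE e)
  simp only [LinearMap.sub_apply, LinearMap.smul_apply] at k
  simp only [diffMap, LinearMap.sub_apply, LinearMap.comp_apply, hd, h0, LinearMap.zero_apply]
  rw [zero_sub, smul_neg, neg_smul, neg_neg, ← k]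
  abel

theorem diff_add_diff (c'' c' c : M.Choice) : diff c'' c' + diff c' c = diff c'' c := by
  obtain ⟨β, h⟩ := exists_homotopy c' c
  obtain ⟨β', h'⟩ := exists_homotopy c'' c'
  have h'' : IsHomotopy c'' c (β + β') :=
    ⟨add_mem h.deg h'.deg, fun x => by rw [LinearMap.add_apply, map_add, h.d_eq, h'.d_eq]; abel⟩
  rw [diff_eq _ _ _ h, diff_eq _ _ _ h', diff_eq _ _ _ h'', ← map_add, ← sub_eq_zero, ← map_sub,
    Submodule.mkQ_apply, Submodule.Quotient.mk_eq_zero]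
  refine c.mem_IdL₁ (η := 0) (zero_mem _) (fun x => by simp) fun e => ?_
  refine ⟨diffMap c'' c' β' e + diffMap c' c β e - diffMap c'' c (β + β') e,
    by rw [map_sub, map_add, d_diffMap h, d_diffMap h', d_diffMap h'', add_zero, sub_zero],
    ?_, (-2⁻¹ : ℚ) • M.hgr.symProd (-1) β β' (M.inclE e), ?_⟩
  · have : (delta c'' c' β' h' + delta c' c β h - delta c'' c (β + β') h'').1 e =
      M.cls ⟨_, d_diffMap h' e⟩ + M.cls ⟨_, d_diffMap h e⟩ - M.cls ⟨_, d_diffMap h'' e⟩ := rfl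
    rw [this, ← map_add, ← map_sub]
    rfl
  · rw [M.symProd_zero_left, LinearMap.zero_apply, sub_zero, map_smul,
      M.d_symProd_neg h.deg h'.deg]
    have hα : c'.α = c.α + M.d ∘ₗ β := LinearMap.ext fun x => by
      rw [LinearMap.add_apply, LinearMap.comp_apply, h.d_eq]; abel
    have key : M.hgr.symProd 0 (β + β') (c.α + (2⁻¹ : ℚ) • M.d ∘ₗ (β + β')) -
        M.hgr.symProd 0 β' (c'.α + (2⁻¹ : ℚ) • M.d ∘ₗ β') -
        M.hgr.symProd 0 β (c.α + (2⁻¹ : ℚ) • M.d ∘ₗ β) =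
        (-2⁻¹ : ℚ) • (M.hgr.symProd 0 β' (M.d ∘ₗ β) - M.hgr.symProd 0 β (M.d ∘ₗ β')) := by
      rw [hα]
      refine M.hgr.symSq_ext fun i x hx j y hy => ?_
      simp only [LinearMap.sub_apply, LinearMap.smul_apply, M.hgr.symProd_mk _ _ _ hx hy,
        LinearMap.add_apply, LinearMap.comp_apply, map_add, mul_add, add_mul, mul_smul_comm]
      module
    have k := LinearMap.congr_fun key (M.inclE e)
    simp only [LinearMap.sub_apply, LinearMap.smul_apply] at k
    rw [← k]
    simp only [diffMap, LinearMap.sub_apply, LinearMap.comp_apply]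
    abel

theorem diff_self (c : M.Choice) : diff c c = 0 := by
  have := diff_add_diff c c c
  rwa [add_eq_left] at this

theorem diff_rev (c' c : M.Choice) : diff c c' = - diff c' c :=
  eq_neg_of_add_eq_zero_left ((diff_add_diff c c' c).trans c.diff_self)

/-- The cochain choice `(α, γ + αδ)`. -/
def translate (c : M.Choice) (δ : M.L₂) : M.Choice where
  α := c.α
  γ := c.γ + c.α ∘ₗ δ.1
  α_deg := c.α_deg
  α_closed := c.α_closed
  α_class := c.α_class
  γ_deg := add_mem c.γ_deg (Grading.homs_comp c.α_deg δ.2 (add_zero _))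
  d_γ e := by
    rw [LinearMap.add_apply, map_add, LinearMap.comp_apply, c.α_closed, add_zero, c.d_γ]

theorem diff_translate (c : M.Choice) (δ : M.L₂) : diff (c.translate δ) c = M.IdL₁.mkQ δ := by
  have h : IsHomotopy (c.translate δ) c 0 := ⟨zero_mem _, fun x => by simp [translate]⟩
  rw [diff_eq _ _ _ h]
  congr 1
  refine Subtype.ext (LinearMap.ext fun e => ?_)
  rw [delta_apply]
  refine Eq.trans (congrArg M.cls (Subtype.ext ?_)) (c.α_class (δ.1 e))
  simp only [diffMap, LinearMap.sub_apply, LinearMap.comp_apply, M.symProd_zero_left]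
  simp [translate]

end Choice

/-- Two cochain choices are equivalent if their difference in `L₂ / Id L₁` vanishes. -/
def choiceSetoid : Setoid M.Choice where
  r c' c := Choice.diff c' c = 0
  iseqv :=
    { refl := Choice.diff_self
      symm := fun {c c'} h => by rw [Choice.diff_rev, h, neg_zero]
      trans := fun {c c' c''} h h' => by rw [← Choice.diff_add_diff c c' c'', h, h', add_zero] }

/-- The set `𝒞` of equivalence classes of cochain choices. -/
def Classes : Type u := Quotient M.choiceSetoid

variable {M}

/-- The equivalence class of a cochain choice. -/
def Choice.toClass (c : M.Choice) : M.Classes := Quotient.mk M.choiceSetoid c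

theorem toClass_eq {c' c : M.Choice} : c'.toClass = c.toClass ↔ Choice.diff c' c = 0 :=
  Quotient.eq (r := M.choiceSetoid)

theorem toClass_surjective (p : M.Classes) : ∃ c : M.Choice, c.toClass = p := Quotient.exists_rep p

instance : Nonempty M.Classes := Nonempty.map Choice.toClass inferInstance

/-- `v + [c] = [(α, γ + αδ)]`, for any `δ ∈ L₂` representing `v`. -/
instance : VAdd (M.L₂ ⧸ M.IdL₁) M.Classes where
  vadd v := Quotient.map (sa := M.choiceSetoid) (sb := M.choiceSetoid)
    (fun c => c.translate v.out) (fun c c' (h : Choice.diff c c' = 0) => by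
      show Choice.diff _ _ = 0
      rw [← Choice.diff_add_diff _ c, ← Choice.diff_add_diff c c', h,
        Choice.diff_rev (c'.translate v.out) c', Choice.diff_translate, Choice.diff_translate, zero_add, add_neg_cancel])

theorem mkQ_out (v : M.L₂ ⧸ M.IdL₁) : M.IdL₁.mkQ v.out = v := Quotient.out_eq v

theorem mkQ_vadd (δ : M.L₂) (c : M.Choice) :
    M.IdL₁.mkQ δ +ᵥ c.toClass = (c.translate δ).toClass := by
  show (c.translate (M.IdL₁.mkQ δ).out).toClass = _
  rw [toClass_eq, ← Choice.diff_add_diff _ c, Choice.diff_rev _ c, Choice.diff_translate,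
    Choice.diff_translate, mkQ_out, add_neg_cancel]

/-- `[c'] - [c]` is the class of `δ(c', c)`. -/
instance : VSub (M.L₂ ⧸ M.IdL₁) M.Classes where
  vsub := Quotient.lift₂ (s₁ := M.choiceSetoid) (s₂ := M.choiceSetoid) Choice.diff
    (fun a b a' b' (h : Choice.diff a a' = 0) (h' : Choice.diff b b' = 0) => by
      rw [← Choice.diff_add_diff a a' b, ← Choice.diff_add_diff a' b' b, h, Choice.diff_rev b b',
        h', neg_zero, zero_add, add_zero])

theorem toClass_vsub (c' c : M.Choice) : c'.toClass -ᵥ c.toClass = Choice.diff c' c := rfl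

theorem zero_vadd' (p : M.Classes) : (0 : M.L₂ ⧸ M.IdL₁) +ᵥ p = p := by
  obtain ⟨c, rfl⟩ := toClass_surjective p
  rw [← map_zero M.IdL₁.mkQ, mkQ_vadd, toClass_eq, Choice.diff_translate, map_zero]

theorem add_vadd' (v w : M.L₂ ⧸ M.IdL₁) (p : M.Classes) : (v + w) +ᵥ p = v +ᵥ (w +ᵥ p) := by
  obtain ⟨c, rfl⟩ := toClass_surjective p
  rw [← mkQ_out v, ← mkQ_out w, ← map_add, mkQ_vadd, mkQ_vadd, mkQ_vadd, toClass_eq,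
    ← Choice.diff_add_diff _ c, Choice.diff_rev ((c.translate w.out).translate v.out) c,
    ← Choice.diff_add_diff ((c.translate w.out).translate v.out) (c.translate w.out) c,
    Choice.diff_translate, Choice.diff_translate, Choice.diff_translate, map_add, add_neg_cancel]

instance : AddAction (M.L₂ ⧸ M.IdL₁) M.Classes where
  zero_vadd := zero_vadd'
  add_vadd := add_vadd'

/-- The set `𝒞` is an affine space over `L₂ / Id L₁`. -/
instance : AddTorsor (M.L₂ ⧸ M.IdL₁) M.Classes where
  vsub_vadd' p q := by
    obtain ⟨c', rfl⟩ := toClass_surjective p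
    obtain ⟨c, rfl⟩ := toClass_surjective q
    show Choice.diff c' c +ᵥ c.toClass = c'.toClass
    rw [← mkQ_out (Choice.diff c' c), mkQ_vadd, toClass_eq, ← Choice.diff_add_diff _ c,
      Choice.diff_translate, mkQ_out, Choice.diff_rev c' c, add_neg_cancel]
  vadd_vsub' v p := by
    obtain ⟨c, rfl⟩ := toClass_surjective p
    show (v +ᵥ c.toClass) -ᵥ c.toClass = v
    rw [← mkQ_out v, mkQ_vadd, toClass_vsub, Choice.diff_translate]

end CDGA

end

/-! Every change of cochain choice is a composite of two moves (`eq_perturb_addClosed`). Given `β`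
with `dβ = α' - α`, add to `γ` the map `ω = γ' - γ - β(α + ½ dβ)`, which has closed values on `E`,
and then pass from `(α, γ)` to `(α + dβ, γ + β(α + ½ dβ))`. The first move accounts for the whole
transformation rule; the second does not affect the Massey tensor.

For the first move, maps of degree `-1` into a graded commutative algebra have a symmetric wedge
product, so `α(γ + ω)² = αγ² + α(γ ∧ ω) + αω²`. The cross term equals `((αγ)ω) ∘ (Id j)` by
`mulMap_wedge`, and `Id j` sends `𝒟` into `K[H ⊗ E] ⊗ E`, where `αγ` is closed with class `T_c`.
Hence the cross term induces `(T_c δ) ∘ (Id j)` and the last term `Id δ²`, with `δ` the class of `ω`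
(`P_addClosed`).

For the second move, join the two choices by the path `α_t = α + t dβ`, `γ_t = γ + tβα + ½t² β dβ`,
which satisfies `dγ_t/dt = βα_t`. The derivative of `α_t γ_t²` is `(dβ)γ_t² + α_t(γ_t ∧ βα_t)`, and
on `𝒟` this is the boundary of `βγ_t²` (`d_mulMap_altSquare`). The reason is that the derivative of
`α³` along `β` is defined on all of `𝒢³H` (`cubeDeriv`), so its pullback to `H ⊗ E` vanishes on `K[H
⊗ E]`. Integrating over `[0, 1]` exhibits the change of `αγ²` as exact (`P_perturb`).

A representative `δ` given in advance is realised exactly by adjusting `β` (`exists_delta_eq`),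
which yields `P_sub_P`. The remaining claims are formal consequences. The right-hand side is a
difference of two values of `P`, hence depends only on the class of `δ`; polarising this
independence shows that `Id(δ ∧ ε)` vanishes for `δ` in `Id L₁` (`wedgeTerm_eq_zero`), so it
descends to a bilinear map on the quotient. -/

noncomputable section

/-! ### Bilinearity, symmetry and associativity of products of graded maps -/

namespace Grading

variable {V W U : Type*} [AddCommGroup V] [Module ℚ V] [AddCommGroup W] [Module ℚ W]
  [AddCommGroup U] [Module ℚ U] {R : Type*} [Ring R] [Algebra ℚ R]

theorem mulMap_add_left (G : Grading V) (s : ℤ) (f f' : V →ₗ[ℚ] R) (g : W →ₗ[ℚ] R) :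
    G.mulMap s (f + f') g = G.mulMap s f g + G.mulMap s f' g := by
  simp [mulMap, LinearMap.add_comp, TensorProduct.map_add_left, LinearMap.comp_add]

theorem mulMap_add_right (G : Grading V) (s : ℤ) (f : V →ₗ[ℚ] R) (g g' : W →ₗ[ℚ] R) :
    G.mulMap s f (g + g') = G.mulMap s f g + G.mulMap s f g' := by
  simp [mulMap, TensorProduct.map_add_right, LinearMap.comp_add]

theorem mulMap_smul_left (G : Grading V) (s : ℤ) (a : ℚ) (f : V →ₗ[ℚ] R) (g : W →ₗ[ℚ] R) :
    G.mulMap s (a • f) g = a • G.mulMap s f g := by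
  simp [mulMap, LinearMap.smul_comp, TensorProduct.map_smul_left, LinearMap.comp_smul]

theorem mulMap_smul_right (G : Grading V) (s : ℤ) (a : ℚ) (f : V →ₗ[ℚ] R) (g : W →ₗ[ℚ] R) :
    G.mulMap s f (a • g) = a • G.mulMap s f g := by
  simp [mulMap, TensorProduct.map_smul_right, LinearMap.comp_smul]

theorem wedge_add_left (G : Grading V) (s : ℤ) (f f' g : V →ₗ[ℚ] R) :
    G.wedge s (f + f') g = G.wedge s f g + G.wedge s f' g := by
  rw [wedge, mulMap_add_left, LinearMap.add_comp]; rfl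

theorem wedge_add_right (G : Grading V) (s : ℤ) (f g g' : V →ₗ[ℚ] R) :
    G.wedge s f (g + g') = G.wedge s f g + G.wedge s f g' := by
  rw [wedge, mulMap_add_right, LinearMap.add_comp]; rfl

theorem wedge_smul_left (G : Grading V) (s : ℤ) (a : ℚ) (f g : V →ₗ[ℚ] R) :
    G.wedge s (a • f) g = a • G.wedge s f g := by
  rw [wedge, mulMap_smul_left, LinearMap.smul_comp]; rfl

theorem wedge_smul_right (G : Grading V) (s : ℤ) (a : ℚ) (f g : V →ₗ[ℚ] R) :
    G.wedge s f (a • g) = a • G.wedge s f g := by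
  rw [wedge, mulMap_smul_right, LinearMap.smul_comp]; rfl

theorem symProd_smul_left (G : Grading V) (s : ℤ) (a : ℚ) (f g : V →ₗ[ℚ] R) :
    G.symProd s (a • f) g = a • G.symProd s f g := by
  refine G.symSq_ext fun i x hx j y hy => ?_
  simp only [LinearMap.smul_apply, G.symProd_mk s _ _ hx hy, smul_mul_assoc, smul_add,
    smul_comm a]

theorem symProd_add_left (G : Grading V) (s : ℤ) (f f' g : V →ₗ[ℚ] R) :
    G.symProd s (f + f') g = G.symProd s f g + G.symProd s f' g := by
  refine G.symSq_ext fun i x hx j y hy => ?_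
  simp only [LinearMap.add_apply, G.symProd_mk s _ _ hx hy, add_mul, smul_add]
  abel

/-- The antisymmetric product of two maps of degree `-1` with commuting values is symmetric. -/
theorem wedge_comm (G : Grading V) {GR : Grading R}
    (hc : ∀ i, ∀ a ∈ GR.deg i, ∀ j, ∀ b ∈ GR.deg j, a * b = ((-1 : ℚ) ^ (i * j)) • (b * a))
    {f g : V →ₗ[ℚ] R} (hf : f ∈ G.homs GR (-1)) (hg : g ∈ G.homs GR (-1)) :
    G.wedge (-1) f g = G.wedge (-1) g f := by
  refine G.altSq_ext fun i x hx j y hy => ?_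
  -- The values have degrees `i - 1` and `j - 1`, so commuting them costs `(-1)^((i-1)(j-1))`. The
  -- odd constant term of this exponent cancels the minus sign of antisymmetry, and each term of one
  -- wedge becomes the other term of the second.
  rw [G.wedge_mk _ _ _ hx hy, G.wedge_mk _ _ _ hx hy, hc _ _ (hf _ _ hx) _ _ (hg _ _ hy),
    hc _ _ (hf _ _ hy) _ _ (hg _ _ hx), smul_smul, smul_smul,
    ← zpow_add₀ (show (-1 : ℚ) ≠ 0 by norm_num), ← zpow_add₀ (show (-1 : ℚ) ≠ 0 by norm_num),
    neg_one_zpow_congr' (m := -1 * i + (i + -1) * (j + -1)) (n := -1 * j + i * j)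
      ⟨-i, by ring⟩,
    neg_one_zpow_congr' (m := -1 * j + i * j + (j + -1) * (i + -1)) (n := -1 * i)
      ⟨i * j - j, by ring⟩, neg_smul, neg_smul]
  abel

/-- The mixed terms `½ f ∧ g` and `½ g ∧ f` are equal by `wedge_comm`, so they combine to `f ∧ g`
with coefficient one. The lemma is used both for cochains and for cohomology. -/
theorem altSquare_add (G : Grading V) {GR : Grading R}
    (hc : ∀ i, ∀ a ∈ GR.deg i, ∀ j, ∀ b ∈ GR.deg j, a * b = ((-1 : ℚ) ^ (i * j)) • (b * a))
    {f g : V →ₗ[ℚ] R} (hf : f ∈ G.homs GR (-1)) (hg : g ∈ G.homs GR (-1)) :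
    G.altSquare (f + g) = G.altSquare f + G.wedge (-1) f g + G.altSquare g := by
  simp only [altSquare, wedge_add_left, wedge_add_right, G.wedge_comm hc hg hf]
  module

/-- `f (g ∧ h) = ((f g) h) ∘ (Id j)`, for `g` and `h` of degree `-1`. -/
theorem mulMap_wedge (G : Grading V) (G' : Grading W) (f : V →ₗ[ℚ] R) (g h : W →ₗ[ℚ] R) :
    G.mulMap (-2) f (G'.wedge (-1) g h) =
      (G.tensor G').mulMap (-1) (G.mulMap (-1) f g) h ∘ₗ idj G' := by
  refine TensorProduct.ext (G.hom_ext fun k x hx => G'.altSq_ext fun i e he j f' hf' => ?_)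
  show G.mulMap (-2) f (G'.wedge (-1) g h) (x ⊗ₜ G'.altMk (e ⊗ₜ f')) =
    (G.tensor G').mulMap (-1) (G.mulMap (-1) f g) h (idj G' (x ⊗ₜ G'.altMk (e ⊗ₜ f')))
  rw [idj_tmul G' x he hf', map_sub, map_smul, mulMap_tmul _ _ _ _ (G.tmul_mem G' hx he),
    mulMap_tmul _ _ _ _ (G.tmul_mem G' hx hf'), G.mulMap_tmul _ _ _ hx, G.mulMap_tmul _ _ _ hx,
    G.mulMap_tmul _ _ _ hx, G'.wedge_mk _ _ _ he hf', mul_sub, smul_sub]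
  simp only [smul_mul_assoc, mul_smul_comm, smul_smul, mul_assoc,
    ← zpow_add₀ (show (-1 : ℚ) ≠ 0 by norm_num)]
  rw [show -1 * (k + i) + -1 * k = -2 * k + -1 * i by ring,
    show i * j + (-1 * (k + j) + -1 * k) = -2 * k + (-1 * j + i * j) by ring]

/-- A map of degree `0` does not alter the Koszul sign. Applied to the inclusion of `K[H ⊗ E]`, this
restricts products to `K[H ⊗ E] ⊗ E`; applied to the symmetrisation map `s`, it shows that products
factoring through `s` vanish on the image of `𝒟`. -/
theorem mulMap_comp_rTensor {G : Grading V} {G' : Grading U} {ι : U →ₗ[ℚ] V}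
    (hι : ι ∈ G'.homs G 0) (s : ℤ) (f : V →ₗ[ℚ] R) (g : W →ₗ[ℚ] R) :
    G.mulMap s f g ∘ₗ ι.rTensor W = G'.mulMap s (f ∘ₗ ι) g := by
  refine TensorProduct.ext (G'.hom_ext fun i x hx => LinearMap.ext fun y => ?_)
  have h := hι _ _ hx
  rw [add_zero] at h
  show G.mulMap s f g (ι x ⊗ₜ y) = G'.mulMap s (f ∘ₗ ι) g (x ⊗ₜ y)
  rw [G.mulMap_tmul _ _ _ h, G'.mulMap_tmul _ _ _ hx]
  rfl

end Grading

/-! ### Changing `γ` by a map with closed values -/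

namespace CDGA

open Grading

variable (M : CDGA.{u})

theorem H_comm' : ∀ i, ∀ a ∈ M.hgr.deg i, ∀ j, ∀ b ∈ M.hgr.deg j,
    a * b = ((-1 : ℚ) ^ (i * j)) • (b * a) := fun _ _ ha _ _ hb => M.H_comm ha hb

section Induced

variable {V W : Type*} [AddCommGroup V] [Module ℚ V] [AddCommGroup W] [Module ℚ W]

theorem d_mulMap_eq_zero (G : Grading V) (s : ℤ) {f : V →ₗ[ℚ] M.A} {g : W →ₗ[ℚ] M.A}
    (hf : ∀ v, M.d (f v) = 0) (hg : ∀ w, M.d (g w) = 0) (z : V ⊗[ℚ] W) :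
    M.d (G.mulMap s f g z) = 0 := by
  have : M.d ∘ₗ G.mulMap s f g = 0 :=
    TensorProduct.ext (G.hom_ext fun i x hx => LinearMap.ext fun y => by
      simp [G.mulMap_tmul s f g hx, M.leibniz', hf, hg])
  exact LinearMap.congr_fun this z

/-- Cohomology is the quotient ring of the closed elements by the exact ones, so taking classes is
multiplicative; the Koszul sign is the same on both sides because it involves only the degree in `V`
and `s`. -/
theorem induced_mulMap (G : Grading V) (s : ℤ) {f : V →ₗ[ℚ] M.A} {g : W →ₗ[ℚ] M.A}
    (hf : ∀ v, M.d (f v) = 0) (hg : ∀ w, M.d (g w) = 0) :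
    M.induced (G.mulMap s f g) (M.d_mulMap_eq_zero G s hf hg) =
      G.mulMap s (M.induced f hf) (M.induced g hg) := by
  refine TensorProduct.ext (G.hom_ext fun i x hx => LinearMap.ext fun y => ?_)
  show M.induced (G.mulMap s f g) _ (x ⊗ₜ y) =
    G.mulMap s (M.induced f hf) (M.induced g hg) (x ⊗ₜ y)
  rw [G.mulMap_tmul _ _ _ hx]
  have h : M.induced f hf x * M.induced g hg y =
    M.cls ⟨f x * g y, M.Z.mul_mem (hf x) (hg y)⟩ := rfl
  rw [h, ← map_smul]
  exact congrArg M.cls (Subtype.ext (G.mulMap_tmul s f g hx y))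

theorem d_altSquare_eq_zero (G : Grading V) {g : V →ₗ[ℚ] M.A} (hg : ∀ v, M.d (g v) = 0)
    (z : G.AltSq) : M.d (G.altSquare g z) = 0 := by
  rw [altSquare, LinearMap.smul_apply, map_smul]
  exact (congrArg _ (M.d_mulMap_eq_zero G (-1) hg hg _)).trans (smul_zero _)

theorem induced_altSquare (G : Grading V) {g : V →ₗ[ℚ] M.A} (hg : ∀ v, M.d (g v) = 0) :
    M.induced (G.altSquare g) (M.d_altSquare_eq_zero G hg) = G.altSquare (M.induced g hg) := by
  refine LinearMap.ext fun z => ?_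
  have h := LinearMap.congr_fun (M.induced_mulMap G (-1) hg hg) (G.altIncl z)
  exact (map_smul M.cls (2⁻¹ : ℚ) ⟨_, M.d_mulMap_eq_zero G (-1) hg hg _⟩).trans
    (congrArg ((2⁻¹ : ℚ) • ·) h)

end Induced

namespace Choice

variable {M}

theorem induced_α (c : M.Choice) : M.induced c.α c.α_closed = LinearMap.id :=
  LinearMap.ext c.α_class

theorem induced_α_comp (c : M.Choice) (n : M.H →ₗ[ℚ] M.H) :
    M.induced (c.α ∘ₗ n) (fun x => c.α_closed (n x)) = n :=
  LinearMap.ext fun x => c.α_class (n x)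

theorem P_apply (c : M.Choice) (x : M.D) :
    c.P.1 x = M.cls ⟨M.hgr.mulMap (-2) c.α (M.egr.altSquare c.γ) (M.inclD x), by
      show M.d _ = 0
      rw [c.d_αγγ, M.s_idj_inclD, map_zero]⟩ := rfl

/-- The cochain choice `(α, γ + ω)`, for `ω` with closed values. -/
def addClosed (c : M.Choice) (ω : M.E →ₗ[ℚ] M.A) (hω : ω ∈ M.egr.homs M.gr (-1))
    (hω' : ∀ e, M.d (ω e) = 0) : M.Choice where
  α := c.α
  γ := c.γ + ω
  α_deg := c.α_deg
  α_closed := c.α_closed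
  α_class := c.α_class
  γ_deg := add_mem c.γ_deg hω
  d_γ e := by rw [LinearMap.add_apply, map_add, hω', add_zero, c.d_γ]

/-- The factor `αγ` need not be closed on `H ⊗ E`, only on `K[H ⊗ E]`. Rewriting `α(γ ∧ ω)` as
`((αγ)ω) ∘ (Id j)` and factoring `Id j` on `𝒟` through `K[H ⊗ E] ⊗ E` makes both factors closed,
with classes `T_c` and the class of `ω`. -/
theorem tripleTerm_apply (c : M.Choice) (ω : M.E →ₗ[ℚ] M.A) (hω : ω ∈ M.egr.homs M.gr (-1))
    (hω' : ∀ e, M.d (ω e) = 0) (x : M.D) :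
    ∃ h, (c.tripleTerm (L₂.mk M (M.induced ω hω') (M.induced_mem _ hω))).1 x =
      M.cls ⟨M.hgr.mulMap (-2) c.α (M.egr.wedge (-1) c.γ ω) (M.inclD x), h⟩ := by
  have hK : ∀ k, M.d ((M.hgr.mulMap (-1) c.α c.γ ∘ₗ M.inclK) k) = 0 := fun k => by
    rw [LinearMap.comp_apply, c.d_αγ, M.s_inclK, map_zero]
  have e1 : M.hgr.mulMap (-2) c.α (M.egr.wedge (-1) c.γ ω) (M.inclD x) =
      M.kgr.mulMap (-1) (M.hgr.mulMap (-1) c.α c.γ ∘ₗ M.inclK) ω (M.idjD x) := by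
    rw [mulMap_wedge, ← mulMap_comp_rTensor M.inclK_mem]
    exact congrArg ((M.hgr.tensor M.egr).mulMap (-1) (M.hgr.mulMap (-1) c.α c.γ) ω)
      (M.inclKE_idjD x).symm
  have h := M.d_mulMap_eq_zero M.kgr (-1) hK hω' (M.idjD x)
  refine ⟨(congrArg M.d e1).trans h, ?_⟩
  have e2 := LinearMap.congr_fun (M.induced_mulMap M.kgr (-1) hK hω') (M.idjD x)
  exact e2.symm.trans (congrArg M.cls (Subtype.ext e1.symm))

/-- Here `α` and `ω²` are closed everywhere, so no restriction to `𝒟` is needed for closedness, and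
the class of `α` is the identity. -/
theorem squareTerm_apply (c : M.Choice) (ω : M.E →ₗ[ℚ] M.A) (hω : ω ∈ M.egr.homs M.gr (-1))
    (hω' : ∀ e, M.d (ω e) = 0) (x : M.D) :
    (M.squareTerm (L₂.mk M (M.induced ω hω') (M.induced_mem _ hω))).1 x =
      M.cls ⟨M.hgr.mulMap (-2) c.α (M.egr.altSquare ω) (M.inclD x),
        M.d_mulMap_eq_zero M.hgr (-2) c.α_closed (M.d_altSquare_eq_zero M.egr hω') _⟩ := by
  have := M.induced_mulMap M.hgr (-2) c.α_closed (M.d_altSquare_eq_zero M.egr hω')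
  rw [c.induced_α, M.induced_altSquare] at this
  exact (LinearMap.congr_fun this (M.inclD x)).symm

/-- The change of `P_c` when `γ` changes by a map with closed values. -/
theorem P_addClosed (c : M.Choice) (ω : M.E →ₗ[ℚ] M.A) (hω : ω ∈ M.egr.homs M.gr (-1))
    (hω' : ∀ e, M.d (ω e) = 0) :
    (c.addClosed ω hω hω').P - c.P =
      c.tripleTerm (L₂.mk M (M.induced ω hω') (M.induced_mem _ hω)) +
        M.squareTerm (L₂.mk M (M.induced ω hω') (M.induced_mem _ hω)) := by
  refine Subtype.ext (LinearMap.ext fun x => ?_)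
  obtain ⟨h1, h2⟩ := c.tripleTerm_apply ω hω hω' x
  have h3 := c.squareTerm_apply ω hω hω' x
  refine (?_ : (c.addClosed ω hω hω').P.1 x - c.P.1 x = _).trans
    (congrArg₂ (· + ·) h2 h3).symm
  rw [P_apply, P_apply, ← map_sub, ← map_add]
  refine congrArg M.cls (Subtype.ext ?_)
  show M.hgr.mulMap (-2) c.α (M.egr.altSquare (c.γ + ω)) (M.inclD x) -
    M.hgr.mulMap (-2) c.α (M.egr.altSquare c.γ) (M.inclD x) =
    M.hgr.mulMap (-2) c.α (M.egr.wedge (-1) c.γ ω) (M.inclD x) +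
    M.hgr.mulMap (-2) c.α (M.egr.altSquare ω) (M.inclD x)
  rw [M.egr.altSquare_add M.comm c.γ_deg hω, mulMap_add_right, mulMap_add_right,
    LinearMap.add_apply, LinearMap.add_apply]
  abel

end Choice

end CDGA

/-! ### Invariance under perturbing `α` by an exact map -/

namespace CDGA

open Grading

namespace Choice

variable {M : CDGA.{u}} (c : M.Choice) (β : M.H →ₗ[ℚ] M.A)

theorem symProd_comm {f g : M.H →ₗ[ℚ] M.A} (hf : f ∈ M.hgr.homs M.gr 0)
    (hg : g ∈ M.hgr.homs M.gr 0) : M.hgr.symProd 0 f g = M.hgr.symProd 0 g f := by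
  refine M.hgr.symSq_ext fun i x hx j y hy => ?_
  have key : ∀ {f g : M.H →ₗ[ℚ] M.A}, f ∈ M.hgr.homs M.gr 0 → g ∈ M.hgr.homs M.gr 0 →
      f x * g y = ((-1 : ℚ) ^ (i * j)) • (g y * f x) := fun hf hg => by
    have h1 := hf _ _ hx
    have h2 := hg _ _ hy
    rw [add_zero] at h1 h2
    exact M.comm _ _ h1 _ _ h2
  rw [M.hgr.symProd_mk _ _ _ hx hy, M.hgr.symProd_mk _ _ _ hx hy, key hf hg, key hg hf]
  simp only [zero_mul, zpow_zero, one_smul, zero_add]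
  exact add_comm _ _

theorem d_comp_mem {β : M.H →ₗ[ℚ] M.A} (hβ : β ∈ M.hgr.homs M.gr (-1)) :
    M.d ∘ₗ β ∈ M.hgr.homs M.gr 0 := homs_comp M.d_homs hβ (by norm_num)

theorem symProd_comp_inclE_mem {β f : M.H →ₗ[ℚ] M.A} (hβ : β ∈ M.hgr.homs M.gr (-1))
    (hf : f ∈ M.hgr.homs M.gr 0) : M.hgr.symProd 0 β f ∘ₗ M.inclE ∈ M.egr.homs M.gr (-1) :=
  homs_comp (symProd_mem M.mul_mem' hβ hf (add_zero _)) M.inclE_mem (zero_add _)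

/-- The cochain choice `(α + dβ, γ + β(α + ½ dβ))`. -/
def perturb (hβ : β ∈ M.hgr.homs M.gr (-1)) : M.Choice where
  α := c.α + M.d ∘ₗ β
  γ := c.γ + M.hgr.symProd 0 β (c.α + (2⁻¹ : ℚ) • M.d ∘ₗ β) ∘ₗ M.inclE
  α_deg := add_mem c.α_deg (d_comp_mem hβ)
  α_closed x := by
    rw [LinearMap.add_apply, map_add, c.α_closed, LinearMap.comp_apply, M.d_d, add_zero]
  α_class x := (M.cls_eq_of_sub (x := β x) _ (c.α_closed x) (by simp)).trans (c.α_class x)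
  γ_deg := add_mem c.γ_deg (symProd_comp_inclE_mem hβ
    (add_mem c.α_deg (Submodule.smul_mem _ _ (d_comp_mem hβ))))
  d_γ e := by
    rw [LinearMap.add_apply, map_add, c.d_γ, LinearMap.comp_apply,
      d_symProd _ _ fun x => by simp [c.α_closed, M.d_d]]
    -- Both sides are `α² + (dβ)α + ½ (dβ)(dβ)`: the halves in front of `α(dβ)` and `(dβ)α` in `(α +
    -- dβ)²` add up by `symProd_comm`, and the factor `½` in `β(α + ½ dβ)` is chosen to match the
    -- last term.
    simp only [symSquare, symProd_add_left, symProd_add_right, symProd_smul_right,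
      symProd_comm c.α_deg (d_comp_mem hβ), LinearMap.add_apply, LinearMap.smul_apply]
    module

/-- `βα² : 𝒢³H → A`, the graded derivation along `β` of `α³`. -/
def cubeDeriv (hβ : β ∈ M.hgr.homs M.gr (-1)) : M.hgr.SymCube →ₗ[ℚ] M.A :=
  M.hgr.cubeLift (M.hgr.mulMap 0 β (LinearMap.mul' ℚ M.A ∘ₗ TensorProduct.map c.α c.α) +
      M.hgr.mulMap (-1) c.α (M.hgr.symProd 0 β c.α ∘ₗ M.hgr.symMk)) (by
    have hs : ∀ {p q : ℤ} {a b : M.A} (_ : a ∈ M.gr.deg p) (_ : b ∈ M.gr.deg q) (z : M.A),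
        a * (b * z) = ((-1 : ℚ) ^ (p * q)) • (b * (a * z)) := fun ha hb z => by
      rw [← mul_assoc, M.comm _ _ ha _ _ hb, smul_mul_assoc, mul_assoc]
    refine Submodule.span_le.2 ?_
    rintro _ (⟨i, j, x, hx, y, hy, k, z, hz, rfl⟩ | ⟨i, j, x, hx, y, hy, k, z, hz, rfl⟩)
    -- Exchange of the first two factors: `β` falls on `x`, `y` or `z`, and each of these three
    -- terms is matched with the term of the exchanged product in which `β` falls on the same
    -- argument, by `e2`, `e1` and `e3` respectively.
    · rw [SetLike.mem_coe, LinearMap.mem_ker]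
      simp only [map_sub, map_smul, LinearMap.add_apply, M.hgr.mulMap_tmul _ _ _ hx,
        M.hgr.mulMap_tmul _ _ _ hy, LinearMap.comp_apply, TensorProduct.map_tmul,
        LinearMap.mul'_apply, M.hgr.symProd_mk _ _ _ hy hz, M.hgr.symProd_mk _ _ _ hx hz]
      have e1 := hs (c.α_mem hx) (hβ _ _ hy) (c.α z)
      have e2 := hs (c.α_mem hy) (hβ _ _ hx) (c.α z)
      have e3 : c.α x * (β z * c.α y) =
          ((-1 : ℚ) ^ (i * (k + -1 + j) + (k + -1) * j)) • (c.α y * (β z * c.α x)) := by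
        rw [M.comm _ _ (c.α_mem hx) _ _ (M.mul_mem (hβ _ _ hz) (c.α_mem hy)),
          M.comm _ _ (hβ _ _ hz) _ _ (c.α_mem hy), smul_mul_assoc, smul_smul, mul_assoc,
          ← zpow_add₀ (by norm_num)]
      simp only [mul_add (c.α _), mul_smul_comm, e1, e2, e3, zero_mul, zpow_zero, one_smul,
        zero_add]
      simp only [smul_add, smul_smul, ← zpow_add₀ (show (-1 : ℚ) ≠ 0 by norm_num)]
      rw [neg_one_zpow_congr (m := -1 * i + i * (j + -1)) (n := i * j) ⟨-i, by ring⟩,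
        neg_one_zpow_congr (m := i * j + (-1 * j + j * (i + -1))) (n := 0)
          ⟨i * j - j, by ring⟩,
        neg_one_zpow_congr (m := -1 * i + (j * k + (i * (k + -1 + j) + (k + -1) * j)))
          (n := i * j + (-1 * j + i * k)) ⟨j * k - i, by ring⟩, zpow_zero, one_smul]
      abel
    -- Exchange of the last two factors: each summand depends on them only through a graded
    -- symmetric product, namely `α²` or `βα`.
    · have h1 : M.hgr.symMk (x ⊗ₜ[ℚ] y - ((-1 : ℚ) ^ (i * j)) • (y ⊗ₜ[ℚ] x)) = 0 := by
        rw [← LinearMap.mem_ker, M.hgr.ker_symMk]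
        exact Submodule.subset_span ⟨i, j, x, hx, y, hy, rfl⟩
      have h2 : (LinearMap.mul' ℚ M.A ∘ₗ TensorProduct.map c.α c.α)
          (x ⊗ₜ[ℚ] y - ((-1 : ℚ) ^ (i * j)) • (y ⊗ₜ[ℚ] x)) = 0 := by
        simp [M.comm _ _ (c.α_mem hx) _ _ (c.α_mem hy)]
      rw [SetLike.mem_coe, LinearMap.mem_ker, ← TensorProduct.tmul_smul,
        ← TensorProduct.tmul_sub, LinearMap.add_apply, M.hgr.mulMap_tmul _ _ _ hz,
        M.hgr.mulMap_tmul _ _ _ hz, h2, LinearMap.comp_apply, h1]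
      simp)

/-- On `q ⊗ e` the derivation puts `β` either on `q` or on `e`, giving the two summands. Neither
need factor through `s` by itself; their sum does, so on the kernel of `s` one is minus the other.
-/
theorem cubeDeriv_comp_s (hβ : β ∈ M.hgr.homs M.gr (-1)) :
    c.cubeDeriv β hβ ∘ₗ M.s =
      M.hgr.mulMap 0 β (M.hgr.symSquare c.α ∘ₗ M.inclE) +
        M.hgr.mulMap (-1) c.α (M.hgr.symProd 0 β c.α ∘ₗ M.inclE) := by
  refine TensorProduct.ext (M.hgr.hom_ext fun i x hx => LinearMap.ext fun e => ?_)
  obtain ⟨w, hw⟩ := M.hgr.symMk_surjective (M.inclE e)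
  have h : c.cubeDeriv β hβ (M.s (x ⊗ₜ e)) =
      (M.hgr.mulMap 0 β (LinearMap.mul' ℚ M.A ∘ₗ TensorProduct.map c.α c.α) +
        M.hgr.mulMap (-1) c.α (M.hgr.symProd 0 β c.α ∘ₗ M.hgr.symMk)) (x ⊗ₜ w) := by
    have : M.s (x ⊗ₜ e) = M.hgr.symMul (x ⊗ₜ M.inclE e) := rfl
    rw [this, ← hw]
    rfl
  refine h.trans ?_
  show _ = (M.hgr.mulMap 0 β (M.hgr.symSquare c.α ∘ₗ M.inclE) +
    M.hgr.mulMap (-1) c.α (M.hgr.symProd 0 β c.α ∘ₗ M.inclE)) (x ⊗ₜ e)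
  rw [LinearMap.add_apply, LinearMap.add_apply, M.hgr.mulMap_tmul _ _ _ hx,
    M.hgr.mulMap_tmul _ _ _ hx, M.hgr.mulMap_tmul _ _ _ hx, M.hgr.mulMap_tmul _ _ _ hx]
  simp only [LinearMap.comp_apply, ← hw, M.hgr.symSquare_mk M.comm c.α_deg]

/-- `d(βγ²) = (dβ)γ² - (βα²)γ ∘ (Id j)`. -/
theorem d_comp_mulMap_altSquare (hβ : β ∈ M.hgr.homs M.gr (-1)) :
    M.d ∘ₗ M.hgr.mulMap (-2) β (M.egr.altSquare c.γ) =
      M.hgr.mulMap (-2) (M.d ∘ₗ β) (M.egr.altSquare c.γ) -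
        (M.hgr.tensor M.egr).mulMap (-1)
          (M.hgr.mulMap 0 β (M.hgr.symSquare c.α ∘ₗ M.inclE)) c.γ ∘ₗ M.idj := by
  refine TensorProduct.ext (M.hgr.hom_ext fun k x hx => ?_)
  refine M.egr.altSq_ext fun i e he j f hf => ?_
  show M.d (M.hgr.mulMap (-2) β (M.egr.altSquare c.γ) (x ⊗ₜ M.egr.altMk (e ⊗ₜ f))) =
    M.hgr.mulMap (-2) (M.d ∘ₗ β) (M.egr.altSquare c.γ) (x ⊗ₜ M.egr.altMk (e ⊗ₜ f)) -
      (M.hgr.tensor M.egr).mulMap (-1)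
          (M.hgr.mulMap 0 β (M.hgr.symSquare c.α ∘ₗ M.inclE)) c.γ
        (M.idj (x ⊗ₜ M.egr.altMk (e ⊗ₜ f)))
  have h1 : M.idj (x ⊗ₜ M.egr.altMk (e ⊗ₜ f)) = _ := M.egr.idj_tmul x he hf
  have hf' : M.hgr.symSquare c.α (M.inclE f) ∈ M.gr.deg j := by
    have := M.inclE_mem _ _ hf
    rw [add_zero] at this
    exact c.α_sq_mem this
  -- Since `γ²` sends `e ∧ f` to `(-1)^|e| γ(e)γ(f)`, Leibniz produces three terms. The one with
  -- `dβ` is the first on the right; those with `dγ(e) = α²(e)` and `dγ(f) = α²(f)` give the two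
  -- terms of `Id j`, once `α²(f)` is moved to the left of `γ(e)`.
  rw [h1, map_sub, map_smul, mulMap_tmul _ _ _ _ (M.hgr.tmul_mem M.egr hx he),
    mulMap_tmul _ _ _ _ (M.hgr.tmul_mem M.egr hx hf), M.hgr.mulMap_tmul _ _ _ hx,
    M.hgr.mulMap_tmul _ _ _ hx, M.hgr.mulMap_tmul _ _ _ hx, M.hgr.mulMap_tmul _ _ _ hx,
    M.egr.altSquare_mk M.comm c.γ_deg he hf, mul_smul_comm, map_smul, map_smul,
    M.leibniz _ _ (hβ _ _ hx), M.leibniz _ _ (c.γ_deg _ _ he), c.d_γ, c.d_γ,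
    M.comm _ _ (c.γ_deg _ _ he) _ _ hf']
  simp only [LinearMap.comp_apply, mul_add (β x), mul_smul_comm, mul_assoc,
    zero_mul, zpow_zero, one_smul]
  simp only [smul_add, smul_smul, ← zpow_add₀ (show (-1 : ℚ) ≠ 0 by norm_num)]
  rw [neg_one_zpow_congr' (m := -2 * k + (i + (k + -1))) (n := -1 * (k + i))
      ⟨i - 1, by ring⟩,
    neg_one_zpow_congr (m := -2 * k + (i + (k + -1 + (i + -1 + (i + -1) * j))))
      (n := i * j + -1 * (k + j)) ⟨i - 1, by ring⟩, neg_smul]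
  abel

/-- On `𝒟`, the derivative of `αγ²` along `β` is the boundary of `βγ²`. -/
theorem d_mulMap_altSquare (hβ : β ∈ M.hgr.homs M.gr (-1)) (x : M.D) :
    M.d (M.hgr.mulMap (-2) β (M.egr.altSquare c.γ) (M.inclD x)) =
      M.hgr.mulMap (-2) (M.d ∘ₗ β) (M.egr.altSquare c.γ) (M.inclD x) +
        M.hgr.mulMap (-2) c.α (M.egr.wedge (-1) c.γ (M.hgr.symProd 0 β c.α ∘ₗ M.inclE))
          (M.inclD x) := by
  -- On the image of `𝒟` under `Id j`, whatever factors through `s` in the `H ⊗ E` factor vanishes.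
  -- This trades `(βα²)γ` for `-(α(βα))γ`.
  have h0 : (M.hgr.tensor M.egr).mulMap (-1) (c.cubeDeriv β hβ ∘ₗ M.s) c.γ
      (M.idj (M.inclD x)) = 0 := by
    rw [← mulMap_comp_rTensor M.s_mem, LinearMap.comp_apply, M.s_idj_inclD, map_zero]
  rw [cubeDeriv_comp_s, mulMap_add_left, LinearMap.add_apply, add_eq_zero_iff_neg_eq] at h0
  have h1 := LinearMap.congr_fun (c.d_comp_mulMap_altSquare β hβ) (M.inclD x)
  rw [LinearMap.comp_apply] at h1
  -- The wedge is reordered to `(βα) ∧ γ` so that `mulMap_wedge` turns it into `((α(βα))γ) ∘ (Id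
  -- j)`, the shape occurring in `h0`.
  rw [h1, M.egr.wedge_comm M.comm c.γ_deg (symProd_comp_inclE_mem hβ c.α_deg), mulMap_wedge,
    LinearMap.sub_apply, sub_eq_add_neg]
  exact congrArg _ h0

/-- Perturbing `α` by an exact map does not change `P_c`. -/
theorem P_perturb (hβ : β ∈ M.hgr.homs M.gr (-1)) : (c.perturb β hβ).P = c.P := by
  refine Subtype.ext (LinearMap.ext fun x => ?_)
  have ht (t : ℚ) : t • β ∈ M.hgr.homs M.gr (-1) := Submodule.smul_mem _ t hβ
  let p (t : ℚ) : M.A := M.hgr.mulMap (-2) β (M.egr.altSquare (c.perturb _ (ht t)).γ) (M.inclD x)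
  -- Applied at each point of the path, this says that `d(p t)` is the `t`-derivative of `α_t γ_t²`,
  -- because `dγ_t/dt = βα_t`.
  have hp (t : ℚ) := (c.perturb _ (ht t)).d_mulMap_altSquare β hβ x
  rw [P_apply, P_apply]
  -- integrate `d/dt (α_t γ_t²)` over `[0, 1]` by Boole's rule, exact in this degree
  refine M.cls_eq_of_sub (x := (7 / 90 : ℚ) • p 0 + (32 / 90 : ℚ) • p (1 / 4) +
    (12 / 90 : ℚ) • p (1 / 2) + (32 / 90 : ℚ) • p (3 / 4) + (7 / 90 : ℚ) • p 1) _ _ ?_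
  simp only [map_add, map_smul, p, hp]
  have h1 := symProd_comp_inclE_mem hβ c.α_deg
  have h2 := symProd_comp_inclE_mem hβ (d_comp_mem hβ)
  have hγ := c.γ_deg
  simp only [perturb, LinearMap.comp_smul, symProd_add_right, symProd_smul_right,
    symProd_smul_left, LinearMap.add_comp, LinearMap.smul_comp]
  -- Now `γ_t = γ + tσ + ½t²τ`, and the claim is an identity in the products of `α` and `dβ` with
  -- wedges of `γ`, `σ`, `τ`. As `α_t γ_t²` has degree 5 in `t`, the integrand has degree 4: beyond
  -- Simpson's rule, within Boole's.
  generalize M.hgr.symProd 0 β c.α ∘ₗ M.inclE = σ at *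
  generalize M.hgr.symProd 0 β (M.d ∘ₗ β) ∘ₗ M.inclE = τ at *
  simp only [altSquare, wedge_add_left, wedge_add_right, wedge_smul_left, wedge_smul_right,
    mulMap_add_left, mulMap_add_right, mulMap_smul_left, mulMap_smul_right,
    M.egr.wedge_comm M.comm h1 hγ, M.egr.wedge_comm M.comm h2 hγ, M.egr.wedge_comm M.comm h2 h1,
    LinearMap.add_apply, LinearMap.smul_apply]
  module

end Choice

end CDGA

/-! ### The transformation rule for arbitrary changes of choice -/

namespace CDGA

open Grading

variable {M : CDGA.{u}}

namespace Choice

/-- Every representative of `c' - c` is `δ(c', c)` for a suitable homotopy. -/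
theorem exists_delta_eq (c' c : M.Choice) (δ : M.L₂) (hδ : M.IdL₁.mkQ δ = diff c' c) :
    ∃ (β : M.H →ₗ[ℚ] M.A) (h : IsHomotopy c' c β), delta c' c β h = δ := by
  obtain ⟨β, h⟩ := exists_homotopy c' c
  rw [diff_eq _ _ _ h, Submodule.mkQ_apply, Submodule.mkQ_apply, Submodule.Quotient.eq] at hδ
  obtain ⟨n, hn, hδ⟩ := hδ
  -- The discrepancy between `δ` and `delta c' c β h` is `Id n` on `E`. Subtracting `αn`, which has
  -- closed values, from `β` leaves `dβ` unchanged and adds `(αn)(α + ½ dβ)` to `diffMap`; the class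
  -- of this product is `Id n`.
  have hη : c.α ∘ₗ n ∈ M.hgr.homs M.gr (-1) := homs_comp c.α_deg hn (add_zero _)
  have hd : M.d ∘ₗ (β - c.α ∘ₗ n) = M.d ∘ₗ β := LinearMap.ext fun x => by simp [c.α_closed]
  have h' : IsHomotopy c' c (β - c.α ∘ₗ n) :=
    ⟨sub_mem h.deg hη, fun x => (LinearMap.congr_fun hd x).trans (h.d_eq x)⟩
  refine ⟨β - c.α ∘ₗ n, h', Subtype.ext (LinearMap.ext fun e => ?_)⟩
  have hh : (2⁻¹ : ℚ) • β ∈ M.hgr.homs M.gr (-1) := Submodule.smul_mem _ _ h.deg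
  -- The midpoint `α + ½ dβ` is the first component of the choice perturbed by `½β`, so it too
  -- represents every cohomology class and `cls_symProd` applies to it.
  have hα : c.α + (2⁻¹ : ℚ) • M.d ∘ₗ β = (c.perturb _ hh).α :=
    congrArg (c.α + ·) (LinearMap.comp_smul _ _ _).symm
  have e1 : diffMap c' c (β - c.α ∘ₗ n) e = diffMap c' c β e +
      M.hgr.symProd 0 (c.α ∘ₗ n) (c.perturb _ hh).α (M.inclE e) := by
    rw [diffMap, diffMap, hd, hα, sub_eq_add_neg β, symProd_add_left,
      ← neg_one_smul ℚ (c.α ∘ₗ n), symProd_smul_left]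
    simp only [LinearMap.sub_apply, LinearMap.comp_apply, LinearMap.add_apply,
      LinearMap.smul_apply]
    module
  have hz : M.d (M.hgr.symProd 0 (c.α ∘ₗ n) (c.perturb _ hh).α (M.inclE e)) = 0 := by
    rw [← sub_eq_iff_eq_add'.2 e1, map_sub, d_diffMap h', d_diffMap h, sub_zero]
  have e2 := (c.perturb _ hh).cls_symProd hη (fun x => c.α_closed _) (M.inclE e) hz
  rw [c.induced_α_comp] at e2
  have e3 : δ.1 e - (delta c' c β h).1 e = _ := LinearMap.congr_fun hδ e
  rw [sub_eq_iff_eq_add'] at e3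
  rw [e3, LinearMap.comp_apply, ← e2, delta_apply, delta_apply, ← map_add]
  exact congrArg M.cls (Subtype.ext e1)

/-- This is the definition of `diffMap` solved for `γ'`. The equality is one of choices, not merely
of classes, because adding a closed map to `γ` keeps `α` and so does not disturb the correction `β(α
+ ½ dβ)`. -/
theorem eq_perturb_addClosed {c' c : M.Choice} {β : M.H →ₗ[ℚ] M.A} (h : IsHomotopy c' c β) :
    c' = (c.addClosed (diffMap c' c β) (diffMap_mem h) (d_diffMap h)).perturb β h.deg := by
  have h1 : c'.α = c.α + M.d ∘ₗ β := LinearMap.ext fun x => by simp [h.d_eq]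
  have h2 : c'.γ = c.γ + diffMap c' c β +
      M.hgr.symProd 0 β (c.α + (2⁻¹ : ℚ) • M.d ∘ₗ β) ∘ₗ M.inclE := by
    rw [diffMap]; abel
  cases c'
  simp only [perturb, addClosed, mk.injEq]
  exact ⟨h1, h2⟩

/-- The transformation rule of the pentagonal Massey tensor. -/
theorem P_sub_P (c c' : M.Choice) (δ : M.L₂) (hδ : M.IdL₁.mkQ δ = diff c' c) :
    c'.P - c.P = c.tripleTerm δ + M.squareTerm δ := by
  -- With `β` adapted to `δ`, the representative is by definition the map induced by `diffMap c' c
  -- β`, as `P_addClosed` requires.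
  obtain ⟨β, h, rfl⟩ := exists_delta_eq c' c δ hδ
  refine Eq.trans ?_ (c.P_addClosed (diffMap c' c β) (diffMap_mem h) (d_diffMap h))
  conv_lhs => rw [eq_perturb_addClosed h]
  rw [P_perturb]

theorem P_translate (c : M.Choice) (δ : M.L₂) :
    (c.translate δ).P = c.P + (c.tripleTerm δ + M.squareTerm δ) := by
  rw [← c.P_sub_P _ δ (diff_translate c δ).symm, add_sub_cancel]

/-- Both sides compute `P` of `c.translate δ` minus `P` of `c`, since `δ` and `δ'` represent the
same difference of choices. -/
theorem tripleTerm_add_squareTerm_congr (c : M.Choice) {δ δ' : M.L₂} (h : δ - δ' ∈ M.IdL₁) :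
    c.tripleTerm δ + M.squareTerm δ = c.tripleTerm δ' + M.squareTerm δ' := by
  rw [← c.P_sub_P _ δ (diff_translate c δ).symm, ← c.P_sub_P _ δ']
  rw [diff_translate]
  exact ((Submodule.Quotient.eq _).2 h).symm

theorem tripleTerm_add (c : M.Choice) (δ ε : M.L₂) :
    c.tripleTerm (δ + ε) = c.tripleTerm δ + c.tripleTerm ε :=
  Subtype.ext (LinearMap.ext fun x =>
    LinearMap.congr_fun (M.kgr.mulMap_add_right (-1) c.T δ.1 ε.1) (M.idjD x))

theorem tripleTerm_zero (c : M.Choice) : c.tripleTerm 0 = 0 := by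
  have h := c.tripleTerm_add 0 0
  rwa [add_zero, left_eq_add] at h

end Choice

/-! ### Polarisation and descent to classes of choices -/

theorem squareTerm_add (δ ε : M.L₂) :
    M.squareTerm (δ + ε) = M.squareTerm δ + M.wedgeTerm δ ε + M.squareTerm ε := by
  have h := congrArg (M.hgr.mulMap (-2) LinearMap.id) (M.egr.altSquare_add M.H_comm' δ.2 ε.2)
  rw [mulMap_add_right, mulMap_add_right] at h
  exact Subtype.ext (LinearMap.ext fun x => LinearMap.congr_fun h (M.inclD x))

variable (M) in
/-- `Id(δ ∧ ε)` as a bilinear map on `L₂`. -/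
def wedgeBilin : M.L₂ →ₗ[ℚ] M.L₂ →ₗ[ℚ] M.HomD :=
  LinearMap.mk₂ ℚ M.wedgeTerm
    (fun δ δ' ε => Subtype.ext (LinearMap.ext fun x => LinearMap.congr_fun
      ((congrArg (M.hgr.mulMap (-2) LinearMap.id) (M.egr.wedge_add_left (-1) δ.1 δ'.1 ε.1)).trans
        (M.hgr.mulMap_add_right _ _ _ _)) (M.inclD x)))
    (fun a δ ε => Subtype.ext (LinearMap.ext fun x => LinearMap.congr_fun
      ((congrArg (M.hgr.mulMap (-2) LinearMap.id) (M.egr.wedge_smul_left (-1) a δ.1 ε.1)).trans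
        (M.hgr.mulMap_smul_right _ _ _ _)) (M.inclD x)))
    (fun δ ε ε' => Subtype.ext (LinearMap.ext fun x => LinearMap.congr_fun
      ((congrArg (M.hgr.mulMap (-2) LinearMap.id) (M.egr.wedge_add_right (-1) δ.1 ε.1 ε'.1)).trans
        (M.hgr.mulMap_add_right _ _ _ _)) (M.inclD x)))
    (fun a δ ε => Subtype.ext (LinearMap.ext fun x => LinearMap.congr_fun
      ((congrArg (M.hgr.mulMap (-2) LinearMap.id) (M.egr.wedge_smul_right (-1) a δ.1 ε.1)).trans
        (M.hgr.mulMap_smul_right _ _ _ _)) (M.inclD x)))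

/-- The wedge is the polarisation of the quadratic map `Id δ²`: compare the expansions at `δ + ε`
and `ε + δ`. -/
theorem wedgeTerm_comm (δ ε : M.L₂) : M.wedgeTerm δ ε = M.wedgeTerm ε δ := by
  have h := squareTerm_add δ ε
  rw [add_comm δ ε, squareTerm_add, add_right_comm, add_right_comm (M.squareTerm δ),
    add_comm (M.squareTerm ε)] at h
  exact (add_left_cancel h).symm

theorem squareTerm_zero : M.squareTerm 0 = 0 := by
  have h := squareTerm_add (0 : M.L₂) 0
  have h0 : M.wedgeTerm 0 0 = 0 := map_zero (M.wedgeBilin 0)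
  rwa [h0, add_zero, add_zero, left_eq_add] at h

/-- Fix any choice `c` and let `F(δ) = (T_c δ) ∘ (Id j) + Id δ²`. Its polarisation `F(δ + ε) - F(ε)
- F(δ)` is the wedge, as `T_c δ` is additive in `δ`. Since `F` depends only on classes, `F(δ + ε) =
F(ε)` and `F(δ) = F(0) = 0`. An auxiliary choice is needed although the conclusion involves none. -/
theorem wedgeTerm_eq_zero {δ : M.L₂} (hδ : δ ∈ M.IdL₁) (ε : M.L₂) : M.wedgeTerm δ ε = 0 := by
  obtain ⟨c⟩ : Nonempty M.Choice := inferInstance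
  have h1 := c.tripleTerm_add_squareTerm_congr (δ := δ + ε) (δ' := ε)
    (by rwa [add_sub_cancel_right])
  have h2 := c.tripleTerm_add_squareTerm_congr (δ := δ) (δ' := 0) (by rwa [sub_zero])
  rw [c.tripleTerm_zero, squareTerm_zero, add_zero] at h2
  rw [c.tripleTerm_add, squareTerm_add] at h1
  have h3 : M.wedgeTerm δ ε = c.tripleTerm δ + c.tripleTerm ε +
      (M.squareTerm δ + M.wedgeTerm δ ε + M.squareTerm ε) -
      (c.tripleTerm ε + M.squareTerm ε) - (c.tripleTerm δ + M.squareTerm δ) := by abel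
  rw [h3, h1, h2, sub_self, sub_zero]

variable (M) in
/-- The bilinear map `([δ], [ε]) ↦ Id(δ ∧ ε)` on `L₂ / Id L₁`. -/
def wedgeQuot : (M.L₂ ⧸ M.IdL₁) →ₗ[ℚ] (M.L₂ ⧸ M.IdL₁) →ₗ[ℚ] M.HomD :=
  M.IdL₁.liftQ
    -- The second variable descends first, where symmetry is needed to apply the vanishing in the
    -- first variable; the outer lift then treats the first variable directly.
    ((M.IdL₁.liftQ M.wedgeBilin.flip fun δ hδ => LinearMap.mem_ker.2 (LinearMap.ext fun ε =>
      (wedgeTerm_comm ε δ).trans (wedgeTerm_eq_zero hδ ε))).flip) fun δ hδ => by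
    refine LinearMap.mem_ker.2 (LinearMap.ext fun v => ?_)
    obtain ⟨ε, rfl⟩ := M.IdL₁.mkQ_surjective v
    exact wedgeTerm_eq_zero hδ ε

theorem wedgeQuot_mkQ (δ ε : M.L₂) :
    M.wedgeQuot (M.IdL₁.mkQ δ) (M.IdL₁.mkQ ε) = M.wedgeTerm δ ε := rfl

/-- The pentagonal Massey tensor as a function on equivalence classes of choices. -/
def classP : M.Classes → M.HomD :=
  Quotient.lift (s := M.choiceSetoid) Choice.P fun c c' (h : Choice.diff c c' = 0) => by
    -- For equivalent choices `0` represents the difference, and both terms of the transformation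
    -- rule vanish at `0`.
    have h1 := c'.P_sub_P c 0 (by rw [map_zero, h])
    rwa [c'.tripleTerm_zero, squareTerm_zero, add_zero, sub_eq_zero] at h1

theorem classP_toClass (c : M.Choice) : classP c.toClass = c.P := rfl

end CDGA

end

theorem theorem4p10 (M : CDGA.{u}) :
    -- the transformation rule
    (∀ (c c' : M.Choice) (δ : M.L₂), M.IdL₁.mkQ δ = c'.toClass -ᵥ c.toClass →
      c'.P - c.P = c.tripleTerm δ + M.squareTerm δ) ∧
    -- its right hand side is independent of the representative
    (∀ (c : M.Choice) (δ δ' : M.L₂), δ - δ' ∈ M.IdL₁ →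
      c.tripleTerm δ + M.squareTerm δ = c.tripleTerm δ' + M.squareTerm δ') ∧
    -- `c ↦ P_c` is affine quadratic on the affine space of equivalence classes of choices
    ∃ (Q : M.Classes → M.HomD)
      (B : (M.L₂ ⧸ M.IdL₁) →ₗ[ℚ] (M.L₂ ⧸ M.IdL₁) →ₗ[ℚ] M.HomD),
      (∀ c : M.Choice, Q c.toClass = c.P) ∧
      (∀ δ ε : M.L₂, B (M.IdL₁.mkQ δ) (M.IdL₁.mkQ ε) = M.wedgeTerm δ ε) ∧
      ∀ (p : M.Classes) (v w : M.L₂ ⧸ M.IdL₁),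
        Q ((v + w) +ᵥ p) - Q (v +ᵥ p) - Q (w +ᵥ p) + Q p = B v w := by
  refine ⟨fun c c' δ hδ => c.P_sub_P c' δ hδ,
    fun c δ δ' h => c.tripleTerm_add_squareTerm_congr h,
    CDGA.classP, M.wedgeQuot, CDGA.classP_toClass, CDGA.wedgeQuot_mkQ, fun p v w => ?_⟩
  obtain ⟨c, rfl⟩ := CDGA.toClass_surjective p
  obtain ⟨δ, rfl⟩ := M.IdL₁.mkQ_surjective v
  obtain ⟨ε, rfl⟩ := M.IdL₁.mkQ_surjective w
  -- All four values are expanded around the same `c`; the triple terms are additive and cancel, as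
  -- do the squares, leaving only the cross term.
  rw [← map_add, CDGA.mkQ_vadd, CDGA.mkQ_vadd, CDGA.mkQ_vadd, CDGA.classP_toClass,
    CDGA.classP_toClass, CDGA.classP_toClass, CDGA.classP_toClass, CDGA.Choice.P_translate,
    CDGA.Choice.P_translate, CDGA.Choice.P_translate, CDGA.Choice.tripleTerm_add,
    CDGA.squareTerm_add, CDGA.wedgeQuot_mkQ]
  abel
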